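/- **Setting.** Let $\Omega\subset\mathbb R^N$ ($N\ge 1$) be a bounded open set and $t_0\in\mathbb R$. Let $a\in C([0,\infty))$ with $a(0)=0$ and $a(s)>0$ for $s>0$; let $h\in C((0,\infty))\cap L^1_{\rm loc}([0,\infty))$ be positive on $(0,\infty)$, and put $H(v)=\int_0^v h(r)\,dr$ and $F(v)=h(v)a(v)$ (with $F(0)=0$), where $F$ is assumed locally Lipschitz and nondecreasing on $[0,\infty)$. Let $u=u(x,t)\ge 0$ be a measurable, possibly unbounded, strong solution of $$[H(u)]_t-F(u)\Delta u\le 0\ \text{ in }\Omega\times(t_0,\infty),\qquad u(\cdot,t_0)=u_0\ \text{ in }\Omega,\qquad u=0\ \text{ on }\partial\Omega\times(t_0,\infty),$$ in the following sense: $[H(u)]_t\in L^2(\Omega\times(t_0,\infty))$, with $H(u(\cdot,t))=H(u_0)+\int_{t_0}^t[H(u)]_s\,ds$ a.e. in $\Omega$ for every $t\ge t_0$; for a.e. $t>t_0$, $u(\cdot,t)\in W^{1,2}_0(\Omega)$ and its distributional Laplacian $\Delta u(\cdot,t)$ is a locally integrable function; $F(u)\Delta u\in L^2(\Omega\times(t_0,\infty))$;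 and the differential inequality holds a.e. in $\Omega\times(t_0,\infty)$. Assume that there are constants $p_1,q_1,c_3,\gamma_1,\beta,c_4>0$ such that for all $s\in[0,\infty)$ the following derivatives exist and satisfy $$[H^{p_1}F]'(s)\ge c_3H(s)^{q_1},\qquad [H^{\gamma_1+1}]'(s)\le c_4H(s)^{\beta},$$ with $\beta>q_1/2$. Let $\delta_1=\frac{p_1+1}{\gamma_1+1}$ and assume $1\le\delta_1<2$. Let $\delta_2=1$ if $\delta_1\le\frac N{N-1}$ (with $\frac N{N-1}=\infty$ if $N=1$) and $\delta_2=\frac{\delta_1N}{N+\delta_1}$ otherwise, and let $p_0=\left(\beta-\frac{q_1}2\right)\frac{2\delta_2}{2-\delta_2}$. Let $p_*\ge 0$ satisfy $p_*+1\ge p_0$, and assume that $[FH^{p_*}]'(s)$ exists and is $\ge 0$ for all $s\in[0,\infty)$. Finally assume that $H(u_0)\in L^{p_1+1}(\Omega)\cap L^{p_*+1}(\Omega)$ and that, for a.e. $t>t_0$, $[H(u)]^{p_1}F(u)$ and $[H(u)]^{p_*}F(u)$ belong to $W^{1,2}_0(\Omega)$. Put $$Y(t)=\int_\Omega[H(u(x,t))]^{p_1+1}dx,\qquad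 Z(t)=\int_\Omega[H(u(x,t))]^{p_0}dx,\qquad t\ge t_0.$$ **Corollary.** Both $Y(t)$ and $Z(t)$ are finite for every $t\ge t_0$, and $Z$ is bounded on $[t_0,\infty)$. The function $Y$ is absolutely continuous on $[t_0,T]$ for every $T>t_0$ (hence differentiable a.e.), and there is a constant $C_2>0$ such that $$Y'(t)+C_2[Y(t)]^{2/\delta_1}\le 0\quad\text{at every }t>t_0\text{ at which }Y\text{ is differentiable.}$$ If $Y(t_0)=0$, then $Y(t)=0$ for all $t\ge t_0$. If $Y(t_0)>0$, then, with the same $C_2$, $$Y(t)\le\Big[C_2\,\tfrac{2-\delta_1}{\delta_1}(t-t_0)+Y(t_0)^{-\frac{2-\delta_1}{\delta_1}}\Big]^{-\frac{\delta_1}{2-\delta_1}}\quad\text{for all }t\ge t_0.$$ Consequently $\lim_{t\to\infty}Y(t)=0$. -/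

import Mathlib

open MeasureTheory Set Filter Topology

noncomputable section

namespace Einstein

/-- Points of `ℝ^N` with the Euclidean norm. -/
abbrev Space (N : ℕ) : Type := EuclideanSpace ℝ (Fin N)

/-- `H(v) = ∫₀ᵛ h(r) dr`. -/
def H (h : ℝ → ℝ) (v : ℝ) : ℝ := ∫ r in (0 : ℝ)..v, h r

/-- `F(v) = h(v) a(v)`. As `a(0) = 0` is always assumed, `F(0) = 0` whatever the value `h 0` is. -/
def F (a h : ℝ → ℝ) (v : ℝ) : ℝ := h v * a v

/-- The standing conditions on the diffusion coefficient `a` and on the weight `h`: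
`a` is continuous on `[0,∞)`, vanishes at `0` and is positive elsewhere; `h` is positive and
continuous on `(0,∞)` and integrable up to `0`; `F = h a` is locally Lipschitz and nondecreasing
on `[0,∞)`. -/
structure Coefficients (a h : ℝ → ℝ) : Prop where
  a_cont : ContinuousOn a (Ici 0)
  a_zero : a 0 = 0
  a_pos : ∀ s, 0 < s → 0 < a s
  h_cont : ContinuousOn h (Ioi 0)
  h_pos : ∀ s, 0 < s → 0 < h s
  h_int : ∀ v, 0 ≤ v → IntervalIntegrable h volume 0 v
  F_lip : LocallyLipschitzOn (Ici 0) (F a h)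
  F_mono : MonotoneOn (F a h) (Ici 0)

/-- `[F H^p]' ≥ 0` on `[0,∞)`; the derivative exists at every point (one-sided at `0`). -/
def WeightMonotone (a h : ℝ → ℝ) (p : ℝ) : Prop :=
  ∀ s, 0 ≤ s → ∃ d, HasDerivWithinAt (fun r => F a h r * H h r ^ p) d (Ici 0) s ∧ 0 ≤ d

/-- `[H^{p₁} F]' ≥ c₃ H^{q₁}` on `[0,∞)`; the derivative exists at every point. -/
def LowerStructure (a h : ℝ → ℝ) (p₁ q₁ c₃ : ℝ) : Prop :=
  ∀ s, 0 ≤ s → ∃ d, HasDerivWithinAt (fun r => H h r ^ p₁ * F a h r) d (Ici 0) s ∧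
    c₃ * H h s ^ q₁ ≤ d

/-- `[H^{γ₁+1}]' ≤ c₄ H^β` on `[0,∞)`; the derivative exists at every point. -/
def UpperStructure (h : ℝ → ℝ) (γ₁ β c₄ : ℝ) : Prop :=
  ∀ s, 0 ≤ s → ∃ d, HasDerivWithinAt (fun r => H h r ^ (γ₁ + 1)) d (Ici 0) s ∧
    d ≤ c₄ * H h s ^ β

/-- Test functions: `φ ∈ C_c^∞(Ω)`. -/
def IsTest {N : ℕ} (Ω : Set (Space N)) (φ : Space N → ℝ) : Prop :=
  ContDiff ℝ (⊤ : ℕ∞) φ ∧ HasCompactSupport φ ∧ tsupport φ ⊆ Ω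

/-- `f` belongs to `W₀^{1,2}(Ω)`, the closure of `C_c^∞(Ω)` in `W^{1,2}(Ω)`, and `G` is its
weak gradient. -/
def IsW012 {N : ℕ} (Ω : Set (Space N)) (f : Space N → ℝ) (G : Space N → Space N) : Prop :=
  MemLp f 2 (volume.restrict Ω) ∧ MemLp G 2 (volume.restrict Ω) ∧
  ∃ φ : ℕ → Space N → ℝ, (∀ n, IsTest Ω (φ n)) ∧
    Tendsto (fun n => eLpNorm (fun x => φ n x - f x) 2 (volume.restrict Ω)) atTop (𝓝 0) ∧
    Tendsto (fun n => eLpNorm (fun x => gradient (φ n) x - G x) 2 (volume.restrict Ω))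
      atTop (𝓝 0)

/-- The distributional divergence of the vector field `G` in `Ω` is the locally integrable
function `L`. -/
def HasWeakDiv {N : ℕ} (Ω : Set (Space N)) (G : Space N → Space N) (L : Space N → ℝ) : Prop :=
  LocallyIntegrableOn L Ω volume ∧
  ∀ φ, IsTest Ω φ → ∫ x in Ω, inner ℝ (G x) (gradient φ x) = -∫ x in Ω, L x * φ x

/-- `u = u(t, x) ≥ 0` is a (possibly unbounded) strong solution on `Ω × (t₀,∞)` of
`[H(u)]_t - F(u) Δu ≤ 0`, `u(t₀, ·) = u₀`, `u = 0` on `∂Ω`.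
Here `v_t` stands for `[H(u)]_t` and `Lap` for `Δu`. -/
structure IsSolution {N : ℕ} (Ω : Set (Space N)) (a h : ℝ → ℝ) (t₀ : ℝ)
    (u₀ : Space N → ℝ) (u : ℝ → Space N → ℝ) : Prop where
  nonneg : ∀ t, t₀ ≤ t → ∀ᵐ x ∂(volume.restrict Ω), 0 ≤ u t x
  meas : AEStronglyMeasurable (fun z : ℝ × Space N => u z.1 z.2)
    (volume.restrict (Ioi t₀ ×ˢ Ω))
  initial : ∀ᵐ x ∂(volume.restrict Ω), u t₀ x = u₀ x
  equation : ∃ v_t Lap : ℝ → Space N → ℝ,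
    MemLp (fun z : ℝ × Space N => v_t z.1 z.2) 2 (volume.restrict (Ioi t₀ ×ˢ Ω)) ∧
    (∀ t, t₀ ≤ t → ∀ᵐ x ∂(volume.restrict Ω),
      H h (u t x) = H h (u₀ x) + ∫ s in t₀..t, v_t s x) ∧
    (∀ᵐ t ∂(volume.restrict (Ioi t₀)),
      ∃ G, IsW012 Ω (u t) G ∧ HasWeakDiv Ω G (Lap t)) ∧
    MemLp (fun z : ℝ × Space N => F a h (u z.1 z.2) * Lap z.1 z.2) 2
      (volume.restrict (Ioi t₀ ×ˢ Ω)) ∧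
    ∀ᵐ z ∂((volume : Measure (ℝ × Space N)).restrict (Ioi t₀ ×ˢ Ω)),
      v_t z.1 z.2 - F a h (u z.1 z.2) * Lap z.1 z.2 ≤ 0

/-- `[H(u)]^p F(u) ∈ W₀^{1,2}(Ω)` for almost every time. -/
def PowerInW012 {N : ℕ} (Ω : Set (Space N)) (a h : ℝ → ℝ) (t₀ : ℝ)
    (u : ℝ → Space N → ℝ) (p : ℝ) : Prop :=
  ∀ᵐ t ∂(volume.restrict (Ioi t₀)),
    ∃ G, IsW012 Ω (fun x => H h (u t x) ^ p * F a h (u t x)) G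

/-- `∫_Ω [H(u(x,t))]^p dx`. -/
def powerIntegral {N : ℕ} (Ω : Set (Space N)) (h : ℝ → ℝ) (u : ℝ → Space N → ℝ)
    (p t : ℝ) : ℝ := ∫ x in Ω, H h (u t x) ^ p

/-- `δ₁ = (p₁+1)/(γ₁+1)`. -/
def delta1 (p₁ γ₁ : ℝ) : ℝ := (p₁ + 1) / (γ₁ + 1)

/-- `δ₂ = 1` if `δ₁ ≤ N/(N-1)` and `δ₂ = δ₁ N/(N+δ₁)` otherwise. The condition is written without
division, so that for `N = 1` it always holds (`N/(N-1) = ∞`). -/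
def delta2 (N : ℕ) (δ₁ : ℝ) : ℝ :=
  open Classical in
  if δ₁ * ((N : ℝ) - 1) ≤ N then 1 else δ₁ * N / (N + δ₁)

/-- `p₀ = (β - q₁/2) 2δ₂/(2-δ₂)`. -/
def expP0 (β q₁ δ₂ : ℝ) : ℝ := (β - q₁ / 2) * (2 * δ₂ / (2 - δ₂))

end Einstein

end

/-! Formally, multiply the inequality by `(p₁+1) H(u)^{p₁}` and integrate over `Ω`. Integration by
parts and the lower structure condition give `Y' ≤ -(p₁+1) c₃ ∫ H(u)^{q₁} |∇u|²`. The upper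
condition bounds the gradient of `H(u)^{γ₁+1}` by `c₄ H^β |∇u| = c₄ H^{β-q₁/2} · H^{q₁/2} |∇u|`.
Sobolev from `L^{δ₂}` to `L^{δ₁}`, followed by Hölder with `1/δ₂ = 1/r + 1/2`, yields `Y^{2/δ₁} ≤ D
Z^{(2-δ₂)/δ₂} ∫ H^{q₁} |∇u|²`, because `δ₁(γ₁+1) = p₁+1` and `(β-q₁/2) r = p₀`. The integral of
`H(u)^{p_*+1}` does not increase, and `H^{p₀} ≤ 1 + H^{p_*+1}`, so `Z` is bounded. Hence `Y' ≤ -C₂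
Y^{2/δ₁}`, with `2/δ₁ > 1`, and this integrates to the power decay.

Making this rigorous meets three difficulties. In space, `Δu` is only locally integrable and `b(H)F`
need not be `C¹`. `HasWeakDiv.integral_mul_comp` integrates by parts against bounded `C¹` functions
of `u` vanishing near zero, and `HasWeakDiv.energy_le` reaches monotone weights by averaging; the
growth of the weight enters through difference quotients, and only an inequality is needed. In time,
`energy_identity` applies the chain rule along the paths `t ↦ H(u(t,x))` and Fubini, for bounded
weights `b`. Since `u` may be unbounded, the powers are truncated: `exists_limit_density` removes
the truncation by monotone convergence, which also makes `Y` a primitive of an integrable function.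
`IsW012.gradient_bound` is the Sobolev–Hölder step and `rpow_neg_ge_of_decay` the final scalar
comparison. -/

namespace Einstein

/-! ### Test functions, limits of products, smooth approximation. -/

section Tools

variable {N : ℕ} {Ω : Set (Space N)}

lemma IsTest.differentiable {φ : Space N → ℝ} (hφ : IsTest Ω φ) : Differentiable ℝ φ :=
  hφ.1.differentiable (by simp)

lemma IsTest.continuous {φ : Space N → ℝ} (hφ : IsTest Ω φ) : Continuous φ :=
  hφ.differentiable.continuous

lemma gradient_eq_toDual_symm (φ : Space N → ℝ) :
    gradient φ = fun x => (InnerProductSpace.toDual ℝ (Space N)).symm (fderiv ℝ φ x) := rfl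

lemma norm_gradient (φ : Space N → ℝ) (x : Space N) : ‖gradient φ x‖ = ‖fderiv ℝ φ x‖ := by
  rw [gradient_eq_toDual_symm]; simp

lemma IsTest.continuous_gradient {φ : Space N → ℝ} (hφ : IsTest Ω φ) :
    Continuous (gradient φ) := by
  rw [gradient_eq_toDual_symm]
  exact (LinearIsometryEquiv.continuous _).comp (hφ.1.continuous_fderiv (by simp))

lemma IsTest.hasCompactSupport_gradient {φ : Space N → ℝ} (hφ : IsTest Ω φ) :
    HasCompactSupport (gradient φ) := by
  rw [gradient_eq_toDual_symm]
  exact (hφ.2.1.fderiv (𝕜 := ℝ)).comp_left (map_zero _)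

lemma IsTest.memLp_gradient {φ : Space N → ℝ} (hφ : IsTest Ω φ) :
    MemLp (gradient φ) 2 (volume.restrict Ω) :=
  (hφ.continuous_gradient.memLp_of_hasCompactSupport hφ.hasCompactSupport_gradient).restrict _

/-- Gradient of `p ∘ φ * q ∘ ψ`. -/
lemma gradient_comp_mul_comp {φ ψ : Space N → ℝ} {p q : ℝ → ℝ} {p' q' : ℝ} {x : Space N}
    (hφ : DifferentiableAt ℝ φ x) (hψ : DifferentiableAt ℝ ψ x)
    (hp : HasDerivAt p p' (φ x)) (hq : HasDerivAt q q' (ψ x)) :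
    gradient (fun y => p (φ y) * q (ψ y)) x =
      (q (ψ x) * p') • gradient φ x + (p (φ x) * q') • gradient ψ x := by
  have h1 := (hp.comp_hasFDerivAt x hφ.hasFDerivAt).mul (hq.comp_hasFDerivAt x hψ.hasFDerivAt)
  have h2 : fderiv ℝ (fun y => p (φ y) * q (ψ y)) x = _ := h1.fderiv
  simp only [gradient_eq_toDual_symm, h2, map_add, map_smul, smul_smul, Function.comp]
  rw [add_comm]

/-- An approximating sequence of test functions that also converges almost everywhere. -/
lemma IsW012.exists_seq {f : Space N → ℝ} {G : Space N → Space N} (hf : IsW012 Ω f G) :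
    ∃ φ : ℕ → Space N → ℝ, (∀ n, IsTest Ω (φ n)) ∧
      (∀ᵐ x ∂(volume.restrict Ω), Tendsto (fun n => φ n x) atTop (𝓝 (f x))) ∧
      Tendsto (fun n => eLpNorm (fun x => gradient (φ n) x - G x) 2 (volume.restrict Ω))
        atTop (𝓝 0) := by
  obtain ⟨hfm, -, φ, hφ, h1, h2⟩ := hf
  obtain ⟨ns, hns, hae⟩ := (tendstoInMeasure_of_tendsto_eLpNorm (p := 2) (by simp)
    (fun n => (hφ n).continuous.aestronglyMeasurable) hfm.1 h1).exists_seq_tendsto_ae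
  exact ⟨fun n => φ (ns n), fun n => hφ _, hae, h2.comp hns.tendsto_atTop⟩

/-- Products of boundedly a.e. convergent coefficients and `L²`-convergent vector fields. -/
lemma tendsto_integral_mul_inner {α : Type*} [MeasurableSpace α] {μ : Measure α}
    {E : Type*} [NormedAddCommGroup E] [InnerProductSpace ℝ E]
    {c : ℕ → α → ℝ} {c' : α → ℝ} {M : ℝ} {g : ℕ → α → E} {G : α → E}
    (hc : ∀ n, AEStronglyMeasurable (c n) μ) (hcM : ∀ n, ∀ᵐ x ∂μ, ‖c n x‖ ≤ M)
    (hcc : ∀ᵐ x ∂μ, Tendsto (fun n => c n x) atTop (𝓝 (c' x)))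
    (hg : ∀ n, MemLp (g n) 2 μ) (hG : MemLp G 2 μ)
    (hgG : Tendsto (fun n => eLpNorm (fun x => g n x - G x) 2 μ) atTop (𝓝 0)) :
    Tendsto (fun n => ∫ x, c n x * inner ℝ (G x) (g n x) ∂μ) atTop
      (𝓝 (∫ x, c' x * ‖G x‖ ^ 2 ∂μ)) := by
  -- Split `c n • g n` into `c n • (g n - G)` and `c n • G`: Cauchy–Schwarz kills the first part,
  -- dominated convergence handles the second.
  have key : ∀ n, eLpNorm (fun x => inner ℝ (G x) (c n x • (g n x - G x))) 1 μ ≤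
      1 * eLpNorm G 2 μ * (ENNReal.ofReal M * eLpNorm (fun x => g n x - G x) 2 μ) := by
    intro n
    refine (eLpNorm_le_eLpNorm_mul_eLpNorm'_of_norm (p := 2) (q := 2) hG.1
      ((hc n).smul ((hg n).1.sub hG.1)) (fun a b => inner ℝ a b) 1 ?_).trans ?_
    · exact Eventually.of_forall fun x => by simpa using norm_inner_le_norm (𝕜 := ℝ) _ _
    · gcongr
      · simp
      · refine eLpNorm_le_mul_eLpNorm_of_ae_le_mul ?_ _
        filter_upwards [hcM n] with x hx
        simp only [Pi.smul_apply', Pi.sub_apply]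
        rw [norm_smul]; gcongr
  have hint : ∀ n, Integrable (fun x => inner ℝ (G x) (c n x • (g n x - G x))) μ := by
    intro n
    refine memLp_one_iff_integrable.1 ⟨hG.1.inner ((hc n).smul ((hg n).1.sub hG.1)), ?_⟩
    refine (key n).trans_lt ?_
    have := ((hg n).sub hG).2
    have := hG.2
    exact ENNReal.mul_lt_top (by simpa) (ENNReal.mul_lt_top (by simp) (by assumption))
  have hG2 : Integrable (fun x => ‖G x‖ ^ 2) μ := by
    simpa using hG.norm.integrable_sq
  have hint2 : ∀ n, Integrable (fun x => c n x * ‖G x‖ ^ 2) μ := fun n =>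
    hG2.bdd_mul (hc n) (hcM n)
  have h1 : Tendsto (fun n => ∫ x, inner ℝ (G x) (c n x • (g n x - G x)) ∂μ) atTop (𝓝 0) := by
    rw [tendsto_zero_iff_norm_tendsto_zero]
    have h0 : Tendsto (fun n => (1 * eLpNorm G 2 μ *
        (ENNReal.ofReal M * eLpNorm (fun x => g n x - G x) 2 μ))) atTop (𝓝 0) := by
      have h := ENNReal.Tendsto.const_mul (a := 1 * eLpNorm G 2 μ)
        (ENNReal.Tendsto.const_mul hgG (Or.inr (ENNReal.ofReal_ne_top (r := M))))
        (Or.inr (by simpa using hG.2.ne))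
      simpa using h
    have h3 := tendsto_of_tendsto_of_tendsto_of_le_of_le tendsto_const_nhds h0
      (fun n => zero_le) key
    have h4 := (ENNReal.tendsto_toReal ENNReal.zero_ne_top).comp h3
    refine tendsto_of_tendsto_of_tendsto_of_le_of_le tendsto_const_nhds h4
      (fun n => norm_nonneg _) (fun n => ?_)
    refine (norm_integral_le_lintegral_norm _).trans ?_
    simp only [Function.comp, eLpNorm_one_eq_lintegral_enorm, ofReal_norm, le_refl]
  have h2 : Tendsto (fun n => ∫ x, c n x * ‖G x‖ ^ 2 ∂μ) atTop
      (𝓝 (∫ x, c' x * ‖G x‖ ^ 2 ∂μ)) := by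
    refine tendsto_integral_of_dominated_convergence (fun x => M * ‖G x‖ ^ 2)
      (fun n => (hint2 n).1) (hG2.const_mul M) (fun n => ?_) ?_
    · filter_upwards [hcM n] with x hx
      rw [norm_mul, Real.norm_of_nonneg (sq_nonneg ‖G x‖)]; gcongr
    · filter_upwards [hcc] with x hx
      exact hx.mul_const _
  have h3 := h1.add h2
  rw [zero_add] at h3
  refine h3.congr fun n => ?_
  rw [← integral_add (hint n) (hint2 n)]
  refine integral_congr_ae (Eventually.of_forall fun x => ?_)
  simp only [inner_smul_right, inner_sub_right, real_inner_self_eq_norm_sq]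
  ring

/-- Polynomial approximation in `C¹` on a compact interval. -/
lemma exists_polynomial_near_C1 {θ θ' : ℝ → ℝ} (hθ : ∀ s, HasDerivAt θ (θ' s) s)
    (hθ' : Continuous θ') {R δ : ℝ} (hR : 0 ≤ R) (hδ : 0 < δ) :
    ∃ P : Polynomial ℝ, ∀ s ∈ Icc (-R) R,
      |P.eval s - θ s| ≤ δ ∧ |P.derivative.eval s - θ' s| ≤ δ := by
  -- The polynomial is an antiderivative of an approximation of `θ'`, matched with `θ` at 0.
  -- Integrating over a length at most `R` multiplies the error by at most `R`, hence the smaller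
  -- tolerance.
  set δ' := δ / (R + 1)
  have hδ' : 0 < δ' := by positivity
  have hδδ : δ' ≤ δ := div_le_self hδ.le (by linarith)
  have anti : ∀ p : Polynomial ℝ, ∃ q : Polynomial ℝ, q.derivative = p := by
    intro p
    induction p using Polynomial.induction_on' with
    | add p₁ p₂ h₁ h₂ =>
      obtain ⟨q₁, rfl⟩ := h₁
      obtain ⟨q₂, rfl⟩ := h₂
      exact ⟨q₁ + q₂, Polynomial.derivative_add⟩
    | monomial n c =>
      refine ⟨Polynomial.monomial (n + 1) (c / (n + 1)), ?_⟩
      rw [Polynomial.derivative_monomial]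
      congr 1
      push_cast
      field_simp
  obtain ⟨p, hp⟩ := exists_polynomial_near_of_continuousOn (-R) R θ' hθ'.continuousOn δ' hδ'
  obtain ⟨q, hq⟩ := anti p
  refine ⟨q + Polynomial.C (θ 0 - q.eval 0), fun s hs => ⟨?_, ?_⟩⟩
  · have hd : ∀ r, HasDerivAt (fun r => q.eval r - θ r) (p.eval r - θ' r) r := fun r => by
      have := q.hasDerivAt r
      rw [hq] at this
      exact this.sub (hθ r)
    have h0 : (0 : ℝ) ∈ Icc (-R) R := ⟨by linarith, hR⟩
    have := (convex_Icc (-R) R).norm_image_sub_le_of_norm_hasDerivWithin_le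
      (f := fun r => q.eval r - θ r) (C := δ') (fun r _ => (hd r).hasDerivWithinAt)
      (fun r hr => (hp r hr).le) h0 hs
    simp only [Polynomial.eval_add, Polynomial.eval_C]
    have e : Polynomial.eval s q + (θ 0 - Polynomial.eval 0 q) - θ s =
      q.eval s - θ s - (q.eval 0 - θ 0) := by ring
    rw [e]
    refine this.trans ?_
    have : ‖s - 0‖ ≤ R := by simpa [abs_le] using hs
    calc δ' * ‖s - 0‖ ≤ δ' * (R + 1) := by gcongr; linarith
      _ = δ := by simp only [δ']; field_simp
  · simp only [Polynomial.derivative_add, hq, Polynomial.derivative_C, add_zero]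
    exact (hp s hs).le.trans hδδ

/-- A smooth cutoff vanishing below `ε / 3` and equal to one above `ε / 2`. -/
lemma exists_cutoff {ε : ℝ} (hε : 0 < ε) : ∃ χ : ℝ → ℝ, ContDiff ℝ (⊤ : ℕ∞) χ ∧ χ 0 = 0 ∧
    (∀ s, 0 ≤ χ s ∧ χ s ≤ 1) ∧ (∀ s, ε / 2 ≤ s → χ s = 1) ∧
    ∃ M, ∀ s, |deriv χ s| ≤ M := by
  let χ : ℝ → ℝ := fun s => Real.smoothTransition ((s - ε / 3) * (6 / ε))
  have hχ : ContDiff ℝ (⊤ : ℕ∞) χ :=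
    Real.smoothTransition.contDiff.comp ((contDiff_id.sub contDiff_const).mul contDiff_const)
  have h1 : ∀ s, ε / 2 ≤ s → χ s = 1 := fun s hs => by
    apply Real.smoothTransition.one_of_one_le
    rw [mul_div_assoc', le_div_iff₀ hε]; linarith
  have h0 : ∀ s, s ≤ ε / 3 → χ s = 0 := fun s hs => by
    apply Real.smoothTransition.zero_of_nonpos
    exact mul_nonpos_of_nonpos_of_nonneg (by linarith) (by positivity)
  refine ⟨χ, hχ, h0 0 (by positivity),
    fun s => ⟨Real.smoothTransition.nonneg _, Real.smoothTransition.le_one _⟩, h1, ?_⟩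
  have hc : Continuous (deriv χ) := hχ.continuous_deriv (by simp)
  obtain ⟨M, hM⟩ := (isCompact_Icc (a := ε / 3) (b := ε / 2)).exists_bound_of_continuousOn
    hc.continuousOn
  refine ⟨max M 0, fun s => ?_⟩
  by_cases hs : s ∈ Icc (ε / 3) (ε / 2)
  · exact (hM s hs).trans (le_max_left _ _)
  · have : deriv χ s = 0 := by
      rw [mem_Icc, not_and_or, not_le, not_le] at hs
      rcases hs with hs | hs
      · have : χ =ᶠ[𝓝 s] fun _ => 0 := by
          filter_upwards [Iio_mem_nhds hs] with r hr using h0 r (le_of_lt hr)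
        rw [this.deriv_eq]; simp
      · have : χ =ᶠ[𝓝 s] fun _ => 1 := by
          filter_upwards [Ioi_mem_nhds hs] with r hr using h1 r (le_of_lt hr)
        rw [this.deriv_eq]; simp
    rw [this]; simp

end Tools

/-! ### Integration by parts against functions of a `W₀^{1,2}` function. -/

section Parts

variable {N : ℕ} {Ω : Set (Space N)}

/-- The factor `χ(ψ)` alone supplies the compact support inside `Ω`, so `p` need not vanish at 0.
This is what allows approximation by arbitrary polynomials. -/
lemma IsTest.comp_mul_comp {φ ψ : Space N → ℝ} (hφ : IsTest Ω φ) (hψ : IsTest Ω ψ)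
    {p χ : ℝ → ℝ} (hp : ContDiff ℝ (⊤ : ℕ∞) p) (hχ : ContDiff ℝ (⊤ : ℕ∞) χ) (hχ0 : χ 0 = 0) :
    IsTest Ω (fun x => p (φ x) * χ (ψ x)) := by
  have hsub : tsupport (fun x => p (φ x) * χ (ψ x)) ⊆ tsupport ψ := by
    refine closure_mono fun x hx => ?_
    contrapose! hx
    simp [Function.notMem_support.1 hx, hχ0]
  exact ⟨(hp.comp hφ.1).mul (hχ.comp hψ.1), hψ.2.1.mono' (subset_closure.trans hsub),
    hsub.trans hψ.2.2⟩

lemma _root_.MeasureTheory.MemLp.integrable_inner_real {α E : Type*} [MeasurableSpace α]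
    {μ : Measure α} [NormedAddCommGroup E] [InnerProductSpace ℝ E] {f g : α → E}
    (hf : MemLp f 2 μ) (hg : MemLp g 2 μ) : Integrable (fun x => inner ℝ (f x) (g x)) μ :=
  (hf.norm.integrable_mul hg.norm).mono' (hf.1.inner hg.1)
    (Eventually.of_forall fun _ => norm_inner_le_norm _ _)

/-- Polynomials converging to `θ` in `C¹` along the ranges of a sequence of test functions. -/
lemma exists_polynomial_seq {f : Space N → ℝ} {φ : ℕ → Space N → ℝ} (hφ : ∀ n, IsTest Ω (φ n))
    (hae : ∀ᵐ x ∂(volume.restrict Ω), Tendsto (fun n => φ n x) atTop (𝓝 (f x)))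
    {θ θ' : ℝ → ℝ} (hθ : ∀ s, HasDerivAt θ (θ' s) s) (hθ' : Continuous θ') {M : ℝ}
    (hM : ∀ s, |θ s| ≤ M) (hM' : ∀ s, |θ' s| ≤ M) :
    ∃ P : ℕ → Polynomial ℝ, (∀ n x, |(P n).eval (φ n x)| ≤ M + 1) ∧
      (∀ n x, |(P n).derivative.eval (φ n x)| ≤ M + 1) ∧
      (∀ᵐ x ∂(volume.restrict Ω),
        Tendsto (fun n => (P n).eval (φ n x)) atTop (𝓝 (θ (f x)))) ∧
      (∀ᵐ x ∂(volume.restrict Ω),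
        Tendsto (fun n => (P n).derivative.eval (φ n x)) atTop (𝓝 (θ' (f x)))) := by
  have hθc : Continuous θ := continuous_iff_continuousAt.2 fun s => (hθ s).continuousAt
  have hR : ∀ n, ∃ R, ∀ x, ‖φ n x‖ ≤ R := fun n =>
    (hφ n).2.1.exists_bound_of_continuous (hφ n).continuous
  choose R hR using hR
  have hP : ∀ n : ℕ, ∃ P : Polynomial ℝ, ∀ s ∈ Icc (-R n) (R n),
      |P.eval s - θ s| ≤ 1 / ((n : ℝ) + 1) ∧ |P.derivative.eval s - θ' s| ≤ 1 / ((n : ℝ) + 1) :=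
    fun n => exists_polynomial_near_C1 hθ hθ' ((norm_nonneg _).trans (hR n 0)) (by positivity)
  choose P hP using hP
  have hmem : ∀ n x, φ n x ∈ Icc (-R n) (R n) := fun n x => abs_le.1 (hR n x)
  have hone : ∀ n : ℕ, 1 / ((n : ℝ) + 1) ≤ 1 := fun n => by
    rw [div_le_one (by positivity)]; linarith [n.cast_nonneg (α := ℝ)]
  have hb : ∀ n x, |(P n).eval (φ n x)| ≤ M + 1 := fun n x => by
    have h1 := (hP n _ (hmem n x)).1
    have h2 := abs_sub_abs_le_abs_sub ((P n).eval (φ n x)) (θ (φ n x))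
    linarith [hM (φ n x), hone n]
  have hb' : ∀ n x, |(P n).derivative.eval (φ n x)| ≤ M + 1 := fun n x => by
    have h1 := (hP n _ (hmem n x)).2
    have h2 := abs_sub_abs_le_abs_sub ((P n).derivative.eval (φ n x)) (θ' (φ n x))
    linarith [hM' (φ n x), hone n]
  have hlim : ∀ᵐ x ∂(volume.restrict Ω),
      Tendsto (fun n => (P n).eval (φ n x)) atTop (𝓝 (θ (f x))) := by
    filter_upwards [hae] with x hx
    have h1 : Tendsto (fun n => (P n).eval (φ n x) - θ (φ n x)) atTop (𝓝 0) :=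
      squeeze_zero_norm (fun n => (hP n _ (hmem n x)).1) tendsto_one_div_add_atTop_nhds_zero_nat
    simpa using h1.add ((hθc.tendsto _).comp hx)
  have hlim' : ∀ᵐ x ∂(volume.restrict Ω),
      Tendsto (fun n => (P n).derivative.eval (φ n x)) atTop (𝓝 (θ' (f x))) := by
    filter_upwards [hae] with x hx
    have h1 : Tendsto (fun n => (P n).derivative.eval (φ n x) - θ' (φ n x)) atTop (𝓝 0) :=
      squeeze_zero_norm (fun n => (hP n _ (hmem n x)).2) tendsto_one_div_add_atTop_nhds_zero_nat
    simpa using h1.add ((hθ'.tendsto _).comp hx)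
  exact ⟨P, hb, hb', hlim, hlim'⟩

/-- The product `θ(f) χ(ψ)` is an admissible test function for every `θ ∈ C¹` with bounded
derivative and every test function `ψ`. -/
lemma HasWeakDiv.integral_mul_cutoff {f : Space N → ℝ} {G : Space N → Space N} {L : Space N → ℝ}
    (hΩb : Bornology.IsBounded Ω)
    (hf : IsW012 Ω f G) (hL : HasWeakDiv Ω G L) {θ θ' χ : ℝ → ℝ}
    (hθ : ∀ s, HasDerivAt θ (θ' s) s) (hθ' : Continuous θ') {M : ℝ} (hM : ∀ s, |θ s| ≤ M)
    (hM' : ∀ s, |θ' s| ≤ M) (hχ : ContDiff ℝ (⊤ : ℕ∞) χ) (hχ0 : χ 0 = 0)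
    (hχ1 : ∀ s, |χ s| ≤ 1) {ψ : Space N → ℝ} (hψ : IsTest Ω ψ) :
    (∫ x in Ω, (χ (ψ x) * θ' (f x)) * ‖G x‖ ^ 2) +
      ∫ x in Ω, (θ (f x) * deriv χ (ψ x)) * inner ℝ (G x) (gradient ψ x) =
      -∫ x in Ω, L x * (θ (f x) * χ (ψ x)) := by
  obtain ⟨φ, hφ, hae, hgrad⟩ := hf.exists_seq
  have hG := hf.2.1
  have hfm := hf.1.1
  have hfin : IsFiniteMeasure (volume.restrict Ω) :=
    ⟨by simpa using hΩb.measure_lt_top⟩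
  have hM0 : 0 ≤ M := (abs_nonneg _).trans (hM 0)
  have hθc : Continuous θ := continuous_iff_continuousAt.2 fun s => (hθ s).continuousAt
  -- The smooth functions `P n (φ n) χ(ψ)` are genuine test functions, and the three terms of the
  -- identity pass to the limit separately with `ψ` fixed.
  obtain ⟨P, hb, hb', hlim, hlim'⟩ := exists_polynomial_seq hφ hae hθ hθ' hM hM'
  have hχc : Continuous χ := hχ.continuous
  have hχd : Continuous (deriv χ) := hχ.continuous_deriv (by simp)
  have hχψ : Continuous fun x => χ (ψ x) := hχc.comp hψ.continuous
  have hχ'ψ : Continuous fun x => deriv χ (ψ x) := hχd.comp hψ.continuous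
  have hPc : ∀ n, Continuous fun x => (P n).eval (φ n x) := fun n =>
    (P n).continuous.comp (hφ n).continuous
  have hPc' : ∀ n, Continuous fun x => (P n).derivative.eval (φ n x) := fun n =>
    (P n).derivative.continuous.comp (hφ n).continuous
  have hBs : HasCompactSupport (fun x => deriv χ (ψ x) • gradient ψ x) :=
    hψ.hasCompactSupport_gradient.smul_left (f := fun x => deriv χ (ψ x))
  have hBc : Continuous (fun x => deriv χ (ψ x) • gradient ψ x) :=
    hχ'ψ.smul hψ.continuous_gradient
  obtain ⟨B, hB⟩ := hBs.exists_bound_of_continuous hBc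
  have hG1 : Integrable (fun x => ‖G x‖) (volume.restrict Ω) :=
    (hG.integrable (by norm_num)).norm
  have hT1 : Tendsto (fun n => ∫ x in Ω, (χ (ψ x) * (P n).derivative.eval (φ n x)) *
      inner ℝ (G x) (gradient (φ n) x)) atTop
      (𝓝 (∫ x in Ω, (χ (ψ x) * θ' (f x)) * ‖G x‖ ^ 2)) := by
    refine tendsto_integral_mul_inner (M := M + 1)
      (fun n => (hχψ.mul (hPc' n)).aestronglyMeasurable)
      (fun n => Eventually.of_forall fun x => ?_) ?_ (fun n => (hφ n).memLp_gradient) hG hgrad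
    · rw [norm_mul]
      calc _ ≤ 1 * (M + 1) := by
            gcongr
            exacts [hχ1 _, hb' n x]
        _ = M + 1 := one_mul _
    · filter_upwards [hlim'] with x hx using hx.const_mul _
  have hbd : ∀ n x, ‖((P n).eval (φ n x) * deriv χ (ψ x)) * inner ℝ (G x) (gradient ψ x)‖ ≤
      (M + 1) * B * ‖G x‖ := fun n x => by
    have : ((P n).eval (φ n x) * deriv χ (ψ x)) * inner ℝ (G x) (gradient ψ x) =
      (P n).eval (φ n x) * inner ℝ (G x) (deriv χ (ψ x) • gradient ψ x) := by
      rw [inner_smul_right]; ring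
    rw [this, norm_mul, mul_assoc, mul_comm B]
    gcongr
    · exact hb n x
    · exact (norm_inner_le_norm _ _).trans (by gcongr; exact hB x)
  have hm2 : ∀ n, AEStronglyMeasurable (fun x => ((P n).eval (φ n x) * deriv χ (ψ x)) *
      inner ℝ (G x) (gradient ψ x)) (volume.restrict Ω) := fun n =>
    ((hPc n).mul hχ'ψ).aestronglyMeasurable.mul
      (hG.1.inner hψ.continuous_gradient.aestronglyMeasurable)
  have hT2 : Tendsto (fun n => ∫ x in Ω, ((P n).eval (φ n x) * deriv χ (ψ x)) *
      inner ℝ (G x) (gradient ψ x)) atTop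
      (𝓝 (∫ x in Ω, (θ (f x) * deriv χ (ψ x)) * inner ℝ (G x) (gradient ψ x))) := by
    refine tendsto_integral_of_dominated_convergence (fun x => (M + 1) * B * ‖G x‖) hm2
      (hG1.const_mul _) (fun n => Eventually.of_forall (hbd n)) ?_
    filter_upwards [hlim] with x hx using (hx.mul_const _).mul_const _
  -- `L` is only locally integrable; restricting it to the compact set `tsupport ψ` changes nothing
  -- in the product and gives an integrable majorant.
  have hLK : Integrable (fun x => (tsupport ψ).indicator L x) (volume.restrict Ω) :=
    ((hL.1.integrableOn_compact_subset hψ.2.2 hψ.2.1).integrable_indicator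
      (isClosed_tsupport ψ).measurableSet).restrict
  have hsupp : ∀ (c : ℝ) x, L x * (c * χ (ψ x)) = (tsupport ψ).indicator L x * (c * χ (ψ x)) := by
    intro c x
    by_cases hx : x ∈ tsupport ψ
    · rw [indicator_of_mem hx]
    · rw [image_eq_zero_of_notMem_tsupport hx, hχ0]; simp
  have hT3 : Tendsto (fun n => ∫ x in Ω, L x * ((P n).eval (φ n x) * χ (ψ x))) atTop
      (𝓝 (∫ x in Ω, L x * (θ (f x) * χ (ψ x)))) := by
    simp only [hsupp]
    refine tendsto_integral_of_dominated_convergence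
      (fun x => ‖(tsupport ψ).indicator L x‖ * (M + 1))
      (fun n => hLK.1.mul ((hPc n).mul hχψ).aestronglyMeasurable)
      (hLK.norm.mul_const _) (fun n => Eventually.of_forall fun x => ?_) ?_
    · rw [norm_mul, norm_mul]
      gcongr
      calc _ ≤ (M + 1) * 1 := by
            gcongr
            exacts [hb n x, hχ1 _]
        _ = M + 1 := mul_one _
    · filter_upwards [hlim] with x hx using (hx.mul_const _).const_mul _
  refine tendsto_nhds_unique (hT1.add hT2) (hT3.neg.congr fun n => ?_)
  have htest := (hφ n).comp_mul_comp hψ (p := fun s => (P n).eval s)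
    (by simpa using (P n).contDiff_aeval (𝕜 := ℝ) (⊤ : ℕ∞)) hχ hχ0
  rw [← hL.2 _ htest, ← integral_add]
  · refine integral_congr_ae (Eventually.of_forall fun x => ?_)
    simp only
    rw [gradient_comp_mul_comp (p := fun s => (P n).eval s) (hφ n).differentiable.differentiableAt
      hψ.differentiable.differentiableAt ((P n).hasDerivAt _)
      ((hχ.differentiable (by simp)).differentiableAt.hasDerivAt), inner_add_right,
      inner_smul_right, inner_smul_right]
  · have : MemLp (fun x => (χ (ψ x) * (P n).derivative.eval (φ n x)) • gradient (φ n) x) 2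
        (volume.restrict Ω) :=
      (((hχψ.mul (hPc' n)).smul (hφ n).continuous_gradient).memLp_of_hasCompactSupport
        ((hφ n).hasCompactSupport_gradient.smul_left
          (f := fun x => χ (ψ x) * (P n).derivative.eval (φ n x)))).restrict _
    have := hG.integrable_inner_real this
    simpa only [inner_smul_right] using this
  · exact (hG1.const_mul ((M + 1) * B)).mono' (hm2 n) (Eventually.of_forall (hbd n))

/-- Integration by parts against `θ(f)`, where `θ` vanishes near zero. -/
lemma HasWeakDiv.integral_mul_comp {f : Space N → ℝ} {G : Space N → Space N} {L : Space N → ℝ}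
    (hΩb : Bornology.IsBounded Ω)
    (hf : IsW012 Ω f G) (hL : HasWeakDiv Ω G L) {θ θ' : ℝ → ℝ}
    (hθ : ∀ s, HasDerivAt θ (θ' s) s) (hθ' : Continuous θ') {M : ℝ} (hM : ∀ s, |θ s| ≤ M)
    (hM' : ∀ s, |θ' s| ≤ M) {ε : ℝ} (hε : 0 < ε) (h0 : ∀ s ≤ ε, θ s = 0)
    (hint : IntegrableOn (fun x => θ (f x) * L x) Ω) :
    ∫ x in Ω, θ (f x) * L x = -∫ x in Ω, θ' (f x) * ‖G x‖ ^ 2 := by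
  -- Now `ψ` runs through the sequence approximating `f`. In the limit `χ(f) = 1` wherever `θ(f) ≠
  -- 0`, so the cutoff disappears; the cross term vanishes since `χ'(f) = 0` where `f > ε` and `θ(f)
  -- = 0` elsewhere.
  obtain ⟨χ, hχ, hχ0, hχ1, hχ2, M₂, hM₂⟩ := exists_cutoff hε
  have hχ1' : ∀ s, |χ s| ≤ 1 := fun s => abs_le.2 ⟨by linarith [(hχ1 s).1], (hχ1 s).2⟩
  obtain ⟨φ, hφ, hae, hgrad⟩ := hf.exists_seq
  have hG := hf.2.1
  have hfm := hf.1.1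
  have hM0 : 0 ≤ M := (abs_nonneg _).trans (hM 0)
  have hθc : Continuous θ := continuous_iff_continuousAt.2 fun s => (hθ s).continuousAt
  have hχd : Continuous (deriv χ) := hχ.continuous_deriv (by simp)
  have h0' : ∀ s < ε, θ' s = 0 := fun s hs => by
    have : θ =ᶠ[𝓝 s] fun _ => 0 := by
      filter_upwards [Iio_mem_nhds hs] with r hr using h0 r (le_of_lt hr)
    rw [← (hθ s).deriv, this.deriv_eq]; simp
  have hG2 : Integrable (fun x => ‖G x‖ ^ 2) (volume.restrict Ω) := by
    simpa using hG.norm.integrable_sq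
  have hT1 : Tendsto (fun n => ∫ x in Ω, (χ (φ n x) * θ' (f x)) * ‖G x‖ ^ 2) atTop
      (𝓝 (∫ x in Ω, θ' (f x) * ‖G x‖ ^ 2)) := by
    refine tendsto_integral_of_dominated_convergence (fun x => (1 * M) * ‖G x‖ ^ 2)
      (fun n => ((hχ.continuous.comp (hφ n).continuous).aestronglyMeasurable.mul
        (hθ'.comp_aestronglyMeasurable hfm)).mul hG2.1)
      (hG2.const_mul _) (fun n => Eventually.of_forall fun x => ?_) ?_
    · rw [norm_mul, norm_mul, Real.norm_of_nonneg (sq_nonneg ‖G x‖)]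
      gcongr
      exacts [hχ1' _, hM' _]
    · filter_upwards [hae] with x hx
      have h1 : Tendsto (fun n => (χ (φ n x) * θ' (f x)) * ‖G x‖ ^ 2) atTop
        (𝓝 ((χ (f x) * θ' (f x)) * ‖G x‖ ^ 2)) :=
        (((hχ.continuous.tendsto _).comp hx).mul_const _).mul_const _
      have h2 : χ (f x) * θ' (f x) = θ' (f x) := by
        rcases lt_or_ge (f x) ε with h | h
        · rw [h0' _ h, mul_zero]
        · rw [hχ2 _ (by linarith), one_mul]
      rwa [h2] at h1
  have hT2 : Tendsto (fun n => ∫ x in Ω, (θ (f x) * deriv χ (φ n x)) *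
      inner ℝ (G x) (gradient (φ n) x)) atTop (𝓝 0) := by
    have h1 := tendsto_integral_mul_inner (μ := volume.restrict Ω) (M := M * M₂)
      (c := fun n x => θ (f x) * deriv χ (φ n x)) (c' := fun x => 0) (g := fun n => gradient (φ n))
      (fun n => (hθc.comp_aestronglyMeasurable hfm).mul
        (hχd.comp (hφ n).continuous).aestronglyMeasurable)
      (fun n => Eventually.of_forall fun x => ?_) ?_ (fun n => (hφ n).memLp_gradient) hG hgrad
    · simpa using h1
    · rw [norm_mul]
      gcongr
      exacts [hM _, hM₂ _]
    · filter_upwards [hae] with x hx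
      have h1 : Tendsto (fun n => θ (f x) * deriv χ (φ n x)) atTop
        (𝓝 (θ (f x) * deriv χ (f x))) := ((hχd.tendsto _).comp hx).const_mul _
      have h2 : θ (f x) * deriv χ (f x) = 0 := by
        rcases le_or_gt (f x) ε with h | h
        · rw [h0 _ h, zero_mul]
        · have : χ =ᶠ[𝓝 (f x)] fun _ => 1 := by
            filter_upwards [Ioi_mem_nhds h] with r hr using hχ2 r (by linarith [mem_Ioi.1 hr])
          rw [this.deriv_eq]; simp
      rwa [h2] at h1
  have hT3 : Tendsto (fun n => ∫ x in Ω, L x * (θ (f x) * χ (φ n x))) atTop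
      (𝓝 (∫ x in Ω, θ (f x) * L x)) := by
    have e : ∀ n x, L x * (θ (f x) * χ (φ n x)) = (θ (f x) * L x) * χ (φ n x) :=
      fun n x => by ring
    simp only [e]
    refine tendsto_integral_of_dominated_convergence (fun x => ‖θ (f x) * L x‖)
      (fun n => hint.1.mul (hχ.continuous.comp (hφ n).continuous).aestronglyMeasurable)
      hint.norm (fun n => Eventually.of_forall fun x => ?_) ?_
    · rw [norm_mul]
      exact mul_le_of_le_one_right (norm_nonneg _) (hχ1' _)
    · filter_upwards [hae] with x hx
      have h1 : Tendsto (fun n => (θ (f x) * L x) * χ (φ n x)) atTop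
        (𝓝 ((θ (f x) * L x) * χ (f x))) := ((hχ.continuous.tendsto _).comp hx).const_mul _
      have h2 : (θ (f x) * L x) * χ (f x) = θ (f x) * L x := by
        rcases le_or_gt (f x) ε with h | h
        · rw [h0 _ h]; ring
        · rw [hχ2 _ (by linarith), mul_one]
      rwa [h2] at h1
  have h := tendsto_nhds_unique (hT1.add hT2) (hT3.neg.congr fun n =>
    (hL.integral_mul_cutoff hΩb hf hθ hθ' hM hM' hχ hχ0 hχ1' (hφ n)).symm)
  linarith

end Parts

/-! ### Energy bound for monotone, possibly nonsmooth weights. -/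

section EnergyBound

variable {N : ℕ} {Ω : Set (Space N)}

/-- Shifted averages of a continuous function that vanishes on the negative half-line. -/
lemma exists_shifted_average {w : ℝ → ℝ} (hw : Continuous w)
    (hw0 : ∀ s ≤ 0, w s = 0) {η R : ℝ} (hη : 0 < η) :
    ∃ θ : ℝ → ℝ, (∀ s, HasDerivAt θ ((w (min (s - η) R) - w (min (s - 2 * η) R)) / η) s) ∧
      (∀ s ≤ η, θ s = 0) ∧
      ∀ s, ∃ c ∈ Ioo (s - 2 * η) (s - η), θ s = w (min c R) := by
  -- Averaging over `(s - 2η, s - η)` instead of an interval around `s` makes the result vanish up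
  -- to `η` and, for monotone `w`, stay below `w`; the truncation at `R` makes it bounded.
  let v : ℝ → ℝ := fun s => w (min s R)
  have hv : Continuous v := hw.comp (continuous_id.min continuous_const)
  let W : ℝ → ℝ := fun s => ∫ r in (0 : ℝ)..s, v r
  have hW : ∀ s, HasDerivAt W (v s) s := fun s => (hv.integral_hasStrictDerivAt 0 s).hasDerivAt
  have hmean : ∀ s, ∃ c ∈ Ioo (s - 2 * η) (s - η),
      (W (s - η) - W (s - 2 * η)) / η = w (min c R) := fun s => by
    obtain ⟨c, hc, h⟩ := exists_hasDerivAt_eq_slope W v (a := s - 2 * η) (b := s - η)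
      (by linarith) (fun x _ => (hW x).continuousAt.continuousWithinAt) (fun x _ => hW x)
    refine ⟨c, hc, ?_⟩
    rw [show s - η - (s - 2 * η) = η by ring] at h
    exact h.symm
  refine ⟨fun s => (W (s - η) - W (s - 2 * η)) / η, fun s => ?_, fun s hs => ?_, hmean⟩
  · exact (((hW (s - η)).comp_sub_const s η).sub
      ((hW (s - 2 * η)).comp_sub_const s (2 * η))).div_const η
  · obtain ⟨c, hc, h⟩ := hmean s
    simp only [h]
    exact hw0 _ ((min_le_left _ _).trans (by linarith [hc.2]))

/-- Weighted energy bound for a monotone function of a nonnegative `W₀^{1,2}` function. -/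
lemma HasWeakDiv.energy_le {f : Space N → ℝ} {G : Space N → Space N} {L : Space N → ℝ}
    (hΩb : Bornology.IsBounded Ω) (hf : IsW012 Ω f G) (hL : HasWeakDiv Ω G L)
    (hf0 : ∀ᵐ x ∂(volume.restrict Ω), 0 ≤ f x) {w κ : ℝ → ℝ} (hw : Continuous w)
    (hmono : Monotone w) (hw0 : ∀ s ≤ 0, w s = 0) (hκ : Continuous κ) (hκ0 : ∀ s, 0 ≤ κ s)
    {b : ℝ} (hκw : ∀ r s, r ≤ s → s ≤ b → κ r * (s - r) ≤ w s - w r)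
    (hint : IntegrableOn (fun x => w (f x) * L x) Ω) :
    ∫ x in Ω, (Iic b).indicator κ (f x) * ‖G x‖ ^ 2 ≤ -∫ x in Ω, w (f x) * L x := by
  let η : ℕ → ℝ := fun n => 1 / ((n : ℝ) + 1)
  have hη : ∀ n, 0 < η n := fun n => by positivity
  have hη1 : ∀ n, η n ≤ 1 := fun n => by
    simp only [η]; rw [div_le_one (by positivity)]; linarith [n.cast_nonneg (α := ℝ)]
  have hηlim : Tendsto η atTop (𝓝 0) := tendsto_one_div_add_atTop_nhds_zero_nat
  choose θ hθ hθ0 hθc using fun n : ℕ => exists_shifted_average hw hw0 (R := n) (hη n)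
  have hw1 : ∀ s, 0 ≤ w s := fun s => by
    rcases le_total s 0 with h | h
    · exact (hw0 s h).ge
    · exact (hw0 0 le_rfl).ge.trans (hmono h)
  have hG := hf.2.1
  have hfm := hf.1.1
  have hG2 : Integrable (fun x => ‖G x‖ ^ 2) (volume.restrict Ω) := by
    simpa using hG.norm.integrable_sq
  have hθle : ∀ n s, 0 ≤ θ n s ∧ θ n s ≤ w s ∧ θ n s ≤ w n := fun n s => by
    obtain ⟨c, hc, h⟩ := hθc n s
    rw [h]
    exact ⟨hw1 _, hmono ((min_le_left _ _).trans (by linarith [hc.2, hη n])),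
      hmono (min_le_right _ _)⟩
  have hθcont : ∀ n, Continuous (θ n) := fun n =>
    continuous_iff_continuousAt.2 fun s => (hθ n s).continuousAt
  have hθlim : ∀ s, Tendsto (fun n => θ n s) atTop (𝓝 (w s)) := fun s => by
    choose c hc h using fun n => hθc n s
    have hclim : Tendsto c atTop (𝓝 s) := by
      refine tendsto_of_tendsto_of_tendsto_of_le_of_le (g := fun n => s - 2 * η n)
        (h := fun n => s - η n) ?_ ?_ (fun n => (hc n).1.le) (fun n => (hc n).2.le)
      · simpa using tendsto_const_nhds.sub (hηlim.const_mul 2)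
      · simpa using tendsto_const_nhds.sub hηlim
    refine ((hw.tendsto s).comp hclim).congr' ?_
    obtain ⟨m, hm⟩ := exists_nat_ge s
    filter_upwards [eventually_ge_atTop m] with n hn
    have : (m : ℝ) ≤ n := by exact_mod_cast hn
    rw [h n, Function.comp, min_eq_left]
    linarith [(hc n).2, hη n]
  have hd0 : ∀ n s, 0 ≤ (w (min (s - η n) n) - w (min (s - 2 * η n) n)) / η n := fun n s => by
    refine div_nonneg (sub_nonneg.2 (hmono ?_)) (hη n).le
    exact min_le_min_right _ (by linarith [hη n])
  have hdM : ∀ n s, (w (min (s - η n) n) - w (min (s - 2 * η n) n)) / η n ≤ w n / η n := fun n s => by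
    refine div_le_div_of_nonneg_right ?_ (hη n).le
    linarith [hmono (min_le_right (s - η n) n), hw1 (min (s - 2 * η n) n)]
  have hdc : ∀ n, Continuous fun s => (w (min (s - η n) n) - w (min (s - 2 * η n) n)) / η n :=
    fun n => by fun_prop
  -- The inequality `0 ≤ θ n ≤ w` transfers integrability from `w(f) L`, and later provides the
  -- majorant for the limit.
  have hintn : ∀ n, IntegrableOn (fun x => θ n (f x) * L x) Ω := fun n => by
    refine Integrable.mono hint (((hθcont n).comp_aestronglyMeasurable hfm).mul hL.1.aestronglyMeasurable)
      (Eventually.of_forall fun x => ?_)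
    rw [norm_mul, norm_mul, Real.norm_of_nonneg (hθle n _).1, Real.norm_of_nonneg (hw1 _)]
    gcongr
    exact (hθle n _).2.1
  have hparts : ∀ n, ∫ x in Ω, (w (min (f x - η n) n) - w (min (f x - 2 * η n) n)) / η n *
      ‖G x‖ ^ 2 = -∫ x in Ω, θ n (f x) * L x := fun n => by
    rw [hL.integral_mul_comp hΩb hf (hθ n) (hdc n) (M := max (w n) (w n / η n))
      (fun s => ?_) (fun s => ?_) (hη n) (hθ0 n) (hintn n), neg_neg]
    · rw [abs_of_nonneg (hθle n s).1]
      exact (hθle n s).2.2.trans (le_max_left _ _)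
    · rw [abs_of_nonneg (hd0 n s)]
      exact (hdM n s).trans (le_max_right _ _)
  -- As `f ≥ 0` and `η n ≤ 1`, the shifted argument `f - 2η` stays in `[-2, b]` where `f ≤ b`.
  obtain ⟨M, hM⟩ := (isCompact_Icc (a := (-2 : ℝ)) (b := b)).exists_bound_of_continuousOn
    hκ.continuousOn
  have hT1 : Tendsto (fun n => ∫ x in Ω,
      (Iic b).indicator (fun s => κ (s - 2 * η n)) (f x) * ‖G x‖ ^ 2) atTop
      (𝓝 (∫ x in Ω, (Iic b).indicator κ (f x) * ‖G x‖ ^ 2)) := by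
    refine tendsto_integral_of_dominated_convergence (fun x => max M 0 * ‖G x‖ ^ 2) (fun n => ?_)
      (hG2.const_mul _) (fun n => ?_) (Eventually.of_forall fun x => ?_)
    · have : Measurable ((Iic b).indicator (fun s => κ (s - 2 * η n))) :=
        (hκ.comp (continuous_id.sub continuous_const)).measurable.indicator measurableSet_Iic
      exact (this.comp_aemeasurable hfm.aemeasurable).aestronglyMeasurable.mul hG2.1
    · filter_upwards [hf0] with x hx
      rw [norm_mul, Real.norm_of_nonneg (sq_nonneg ‖G x‖)]
      gcongr
      by_cases h : f x ∈ Iic b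
      · rw [indicator_of_mem h]
        refine (hM _ ⟨?_, ?_⟩).trans (le_max_left _ _)
        · linarith [hη1 n]
        · linarith [hη n, mem_Iic.1 h]
      · rw [indicator_of_notMem h]; simp
    · refine Tendsto.mul_const _ ?_
      by_cases h : f x ∈ Iic b
      · simp only [indicator_of_mem h]
        refine (hκ.tendsto _).comp ?_
        simpa using tendsto_const_nhds.sub (hηlim.const_mul 2)
      · simp only [indicator_of_notMem h]; exact tendsto_const_nhds
  have hT2 : Tendsto (fun n => -∫ x in Ω, θ n (f x) * L x) atTop
      (𝓝 (-∫ x in Ω, w (f x) * L x)) := by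
    refine (tendsto_integral_of_dominated_convergence (fun x => ‖w (f x) * L x‖)
      (fun n => (hintn n).1) hint.norm (fun n => Eventually.of_forall fun x => ?_)
      (Eventually.of_forall fun x => (hθlim _).mul_const _)).neg
    rw [norm_mul, norm_mul, Real.norm_of_nonneg (hθle n _).1, Real.norm_of_nonneg (hw1 _)]
    gcongr
    exact (hθle n _).2.1
  refine le_of_tendsto_of_tendsto hT1 hT2 ?_
  obtain ⟨m, hm⟩ := exists_nat_ge b
  filter_upwards [eventually_ge_atTop m] with n hn
  -- For `n ≥ b` the truncation is inactive where `f ≤ b`, and the derivative of `θ n` is a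
  -- difference quotient of `w` over a step `η n`; `hκw` bounds it below by `κ(f - 2η)`. Elsewhere
  -- it is nonnegative.
  have hnb : b ≤ n := hm.trans (by exact_mod_cast hn)
  rw [← hparts n]
  have hI : Integrable (fun x => (w (min (f x - η n) n) - w (min (f x - 2 * η n) n)) / η n *
      ‖G x‖ ^ 2) (volume.restrict Ω) :=
    hG2.bdd_mul ((hdc n).comp_aestronglyMeasurable hfm) (c := w n / η n)
      (Eventually.of_forall fun x => by
        rw [Real.norm_of_nonneg (hd0 n _)]; exact hdM n _)
  refine integral_mono_of_nonneg (Eventually.of_forall fun x => ?_) hI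
    (Eventually.of_forall fun x => ?_)
  · exact mul_nonneg (indicator_nonneg (fun s _ => hκ0 _) _) (sq_nonneg _)
  · refine mul_le_mul_of_nonneg_right ?_ (sq_nonneg _)
    by_cases h : f x ∈ Iic b
    · rw [indicator_of_mem h, le_div_iff₀ (hη n)]
      have h' := mem_Iic.1 h
      rw [min_eq_left (by linarith [hη n]), min_eq_left (by linarith [hη n])]
      refine le_trans (le_of_eq ?_) (hκw _ _ (by linarith [hη n]) (by linarith [hη n]))
      ring
    · rw [indicator_of_notMem h]; exact hd0 n _

end EnergyBound

/-! ### Sobolev inequalities on a bounded set. -/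

section Sobolev

variable {N : ℕ} {Ω : Set (Space N)}

/-- By the fundamental theorem of calculus `|ψ|` is pointwise at most `∫ |ψ'|`, and the support has
finite measure. Dimension one is separate because the Gagliardo–Nirenberg–Sobolev inequality used
otherwise needs an exponent below the dimension. -/
lemma eLpNorm_le_eLpNorm_fderiv_one_dim {Ω : Set (Space 1)} (hΩ : Bornology.IsBounded Ω)
    {δ : ℝ} : ∃ C : NNReal, ∀ ψ : Space 1 → ℝ, ContDiff ℝ 1 ψ → HasCompactSupport ψ →
      Function.support ψ ⊆ Ω →
      eLpNorm ψ (ENNReal.ofReal δ) volume ≤ C * eLpNorm (fderiv ℝ ψ) 1 volume := by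
  let e : ℝ ≃ₗᵢ[ℝ] Space 1 := (OrthonormalBasis.singleton (Fin 1) ℝ).repr
  have he : MeasurePreserving e volume volume := e.measurePreserving
  have hfin : volume Ω ≠ ⊤ := hΩ.measure_lt_top.ne
  refine ⟨(volume Ω ^ (ENNReal.ofReal δ).toReal⁻¹).toNNReal, fun ψ hψ hψc hψs => ?_⟩
  rw [ENNReal.coe_toNNReal (ENNReal.rpow_ne_top_of_nonneg (by positivity) hfin)]
  have hpt : ∀ x, ‖ψ x‖ₑ ≤ eLpNorm (fderiv ℝ ψ) 1 volume := fun x => by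
    have hg : ContDiff ℝ 1 (ψ ∘ e) := hψ.comp e.contDiff
    have hgc : HasCompactSupport (ψ ∘ e) :=
      hψc.comp_isClosedEmbedding e.toHomeomorph.isClosedEmbedding
    have h := HasCompactSupport.enorm_le_lintegral_Ici_deriv hg hgc (e.symm x)
    simp only [Function.comp, LinearIsometryEquiv.apply_symm_apply] at h
    refine h.trans ((setLIntegral_le_lintegral _ _).trans ?_)
    rw [eLpNorm_one_eq_lintegral_enorm, ← he.lintegral_comp_emb
      e.toHomeomorph.measurableEmbedding]
    refine lintegral_mono fun s => ?_
    have h1 : HasDerivAt (ψ ∘ e) (fderiv ℝ ψ (e s) (e 1)) s :=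
      ((hψ.differentiable (by simp)).differentiableAt (x := e s)).hasFDerivAt.comp_hasDerivAt
        s (e.toContinuousLinearEquiv.hasFDerivAt (x := s)).hasDerivAt
    rw [h1.deriv]
    refine (ContinuousLinearMap.le_opENorm _ _).trans ?_
    have : ‖e 1‖ₑ = 1 := by
      rw [← ofReal_norm, e.norm_map]; simp
    rw [this, mul_one]
  have hb := eLpNorm_restrict_eq_of_support_subset (μ := volume) (p := ENNReal.ofReal δ) hψs
  rw [← hb, mul_comm]
  refine (eLpNorm_mono_enorm (g := fun _ => eLpNorm (fderiv ℝ ψ) 1 volume) fun x => ?_).trans ?_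
  · simpa using hpt x
  · by_cases hδ : ENNReal.ofReal δ = 0
    · simp [hδ]
    · rw [eLpNorm_const' _ hδ ENNReal.ofReal_ne_top]
      simp

lemma delta2_pos {δ₁ : ℝ} (hN : 1 ≤ N) (h1 : 1 ≤ δ₁) (h2 : δ₁ < 2) :
    1 ≤ delta2 N δ₁ ∧ delta2 N δ₁ < 2 := by
  have hN' : (1 : ℝ) ≤ N := by exact_mod_cast hN
  unfold delta2
  split_ifs with h
  · norm_num
  · rw [not_le] at h
    have : 0 < N + δ₁ := by linarith
    rw [le_div_iff₀ this, div_lt_iff₀ this]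
    constructor <;> nlinarith

/-- The Sobolev inequality for compactly supported `C¹` functions on a bounded set. -/
lemma exists_sobolev_const (hN : 1 ≤ N) (hΩ : Bornology.IsBounded Ω) {δ₁ : ℝ} (h1 : 1 ≤ δ₁)
    (h2 : δ₁ < 2) : ∃ C : NNReal, ∀ ψ : Space N → ℝ, ContDiff ℝ 1 ψ → HasCompactSupport ψ →
      Function.support ψ ⊆ Ω →
      eLpNorm ψ (ENNReal.ofReal δ₁) volume ≤
        C * eLpNorm (fderiv ℝ ψ) (ENNReal.ofReal (delta2 N δ₁)) volume := by
  rcases hN.eq_or_lt with rfl | hN2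
  · have : delta2 1 δ₁ = 1 := by simp [delta2]
    rw [this, ENNReal.ofReal_one]
    exact eLpNorm_le_eLpNorm_fderiv_one_dim hΩ
  · obtain ⟨hd1, hd2⟩ := delta2_pos hN h1 h2
    have hN' : (2 : ℝ) ≤ N := by exact_mod_cast hN2
    refine ⟨_, fun ψ hψ _ hψs => eLpNorm_le_eLpNorm_fderiv_of_le volume hψ hψs
      (p := (delta2 N δ₁).toNNReal) (q := δ₁.toNNReal) ?_ ?_ ?_ hΩ⟩
    · simpa using hd1
    · rw [finrank_euclideanSpace_fin, Real.toNNReal_lt_natCast]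
      · linarith
      · omega
    · rw [finrank_euclideanSpace_fin, NNReal.coe_inv, Real.coe_toNNReal _ (by linarith),
        Real.coe_toNNReal _ (by linarith), sub_le_iff_le_add]
      -- The requirement is `1/δ₂ - 1/N ≤ 1/δ₁`. For `δ₂ = 1` it is exactly the condition in the
      -- definition of `delta2`; in the other case equality holds.
      unfold delta2
      split_ifs with h
      · rw [inv_one, ← one_div, ← one_div, div_add_div _ _ (by linarith) (by linarith),
          le_div_iff₀ (by nlinarith)]
        linarith
      · refine le_of_eq ?_
        field_simp

/-- Write the difference as `c n • (g n - G) + (c n - c') • G`. The first part is small by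
boundedness of `c n`, the second by dominated convergence, although `c n` converges only almost
everywhere. It gives convergence of the chain-rule gradients. -/
lemma tendsto_eLpNorm_smul_sub {α : Type*} [MeasurableSpace α] {μ : Measure α}
    {E : Type*} [NormedAddCommGroup E] [NormedSpace ℝ E]
    {c : ℕ → α → ℝ} {c' : α → ℝ} {M : ℝ} {g : ℕ → α → E} {G : α → E}
    (hc : ∀ n, AEStronglyMeasurable (c n) μ) (hc' : AEStronglyMeasurable c' μ)
    (hcM : ∀ n x, ‖c n x‖ ≤ M) (hcM' : ∀ x, ‖c' x‖ ≤ M)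
    (hcc : ∀ᵐ x ∂μ, Tendsto (fun n => c n x) atTop (𝓝 (c' x)))
    (hg : ∀ n, AEStronglyMeasurable (g n) μ) (hG : MemLp G 2 μ)
    (hgG : Tendsto (fun n => eLpNorm (fun x => g n x - G x) 2 μ) atTop (𝓝 0)) :
    Tendsto (fun n => eLpNorm (fun x => c n x • g n x - c' x • G x) 2 μ) atTop (𝓝 0) := by
  have hle : ∀ n, eLpNorm (fun x => c n x • g n x - c' x • G x) 2 μ ≤
      ENNReal.ofReal M * eLpNorm (fun x => g n x - G x) 2 μ +
      eLpNorm (fun x => (c n x - c' x) • G x) 2 μ := fun n => by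
    have e : (fun x => c n x • g n x - c' x • G x) =
        (fun x => c n x • (g n x - G x)) + fun x => (c n x - c' x) • G x := by
      funext x; simp only [Pi.add_apply, smul_sub, sub_smul]; abel
    rw [e]
    refine (eLpNorm_add_le ((hc n).smul ((hg n).sub hG.1)) (((hc n).sub hc').smul hG.1)
      (by norm_num)).trans ?_
    refine add_le_add ?_ le_rfl
    refine eLpNorm_le_mul_eLpNorm_of_ae_le_mul (Eventually.of_forall fun x => ?_) _
    change ‖c n x • (g n x - G x)‖ ≤ _
    rw [norm_smul]
    gcongr
    exact hcM n x
  have h2 : Tendsto (fun n => eLpNorm (fun x => (c n x - c' x) • G x) 2 μ) atTop (𝓝 0) := by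
    have h3 : Tendsto (fun n => ∫⁻ x, ‖(c n x - c' x) • G x‖ₑ ^ (2 : ℝ) ∂μ) atTop
        (𝓝 (∫⁻ _, 0 ∂μ)) := by
      refine tendsto_lintegral_of_dominated_convergence'
        (fun x => ‖(2 * M) • G x‖ₑ ^ (2 : ℝ)) (fun n => ?_) (fun n => ?_) ?_ ?_
      · exact (((hc n).sub hc').smul hG.1).enorm.pow_const _
      · refine Eventually.of_forall fun x => ?_
        refine ENNReal.rpow_le_rpow ?_ (by norm_num)
        rw [enorm_smul, enorm_smul]
        gcongr
        rw [enorm_le_iff_norm_le]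
        have h1 := norm_sub_le (c n x) (c' x)
        have h2 := hcM n x
        have h3 := hcM' x
        exact (h1.trans (by linarith)).trans (Real.le_norm_self _)
      · exact (lintegral_rpow_enorm_lt_top_of_eLpNorm_lt_top (p := 2) (by simp) (by simp)
          (hG.const_smul (2 * M)).2).ne
      · filter_upwards [hcc] with x hx
        have h1 : Tendsto (fun n => (c n x - c' x) • G x) atTop (𝓝 0) := by
          have := (hx.sub_const (c' x)).smul_const (G x)
          simpa using this
        have h2 := (ENNReal.continuous_rpow_const (y := 2)).tendsto _ |>.comp h1.enorm
        simpa [Function.comp_def] using h2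
    rw [lintegral_zero] at h3
    have h4 := (ENNReal.continuous_rpow_const (y := 1 / 2)).tendsto _ |>.comp h3
    rw [ENNReal.zero_rpow_of_pos (by norm_num)] at h4
    refine h4.congr fun n => ?_
    rw [eLpNorm_eq_lintegral_rpow_enorm_toReal (by simp) (by simp)]
    simp
  refine tendsto_of_tendsto_of_tendsto_of_le_of_le tendsto_const_nhds ?_ (fun n => zero_le) hle
  have := (ENNReal.Tendsto.const_mul hgG (Or.inr (ENNReal.ofReal_ne_top (r := M)))).add h2
  simpa using this

/-- The Sobolev inequality for `Ψ(f)` with `f ∈ W₀^{1,2}` and `Ψ` of class `C¹`. -/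
lemma IsW012.sobolev_comp {f : Space N → ℝ} {G : Space N → Space N}
    (hΩb : Bornology.IsBounded Ω) (hf : IsW012 Ω f G) {p q : ENNReal} (hq : q ≤ 2)
    (hq1 : 1 ≤ q)
    {C : NNReal} (hC : ∀ ψ : Space N → ℝ, ContDiff ℝ 1 ψ → HasCompactSupport ψ →
      Function.support ψ ⊆ Ω → eLpNorm ψ p volume ≤ C * eLpNorm (fderiv ℝ ψ) q volume)
    {Ψ Ψ' : ℝ → ℝ} (hΨ : ∀ s, HasDerivAt Ψ (Ψ' s) s) (hΨ' : Continuous Ψ') (h0 : Ψ 0 = 0)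
    {M : ℝ} (hM : ∀ s, |Ψ' s| ≤ M) :
    eLpNorm (fun x => Ψ (f x)) p (volume.restrict Ω) ≤
      C * eLpNorm (fun x => Ψ' (f x) • G x) q (volume.restrict Ω) := by
  obtain ⟨φ, hφ, hae, hgrad⟩ := hf.exists_seq
  have hG := hf.2.1
  have hfm := hf.1.1
  have hfin : IsFiniteMeasure (volume.restrict Ω) :=
    ⟨by simpa using hΩb.measure_lt_top⟩
  have hΨc : Continuous Ψ := continuous_iff_continuousAt.2 fun s => (hΨ s).continuousAt
  have hd := tendsto_eLpNorm_smul_sub (μ := volume.restrict Ω) (c := fun n x => Ψ' (φ n x))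
    (c' := fun x => Ψ' (f x)) (fun n => (hΨ'.comp (hφ n).continuous).aestronglyMeasurable)
    (hΨ'.comp_aestronglyMeasurable hfm) (fun n x => hM _) (fun x => hM _)
    (by filter_upwards [hae] with x hx using (hΨ'.tendsto _).comp hx)
    (fun n => (hφ n).continuous_gradient.aestronglyMeasurable) hG hgrad
  have hsm : ∀ n, AEStronglyMeasurable (fun x => Ψ' (φ n x) • gradient (φ n) x - Ψ' (f x) • G x)
      (volume.restrict Ω) := fun n =>
    ((hΨ'.comp (hφ n).continuous).smul (hφ n).continuous_gradient).aestronglyMeasurable.sub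
      ((hΨ'.comp_aestronglyMeasurable hfm).smul hG.1)
  -- The norm of the embedding of `L²` into `L^q` on a set of finite measure. The gradients converge
  -- in `L²`, hence in `L^q`; the left side passes to the limit by Fatou.
  set K : ENNReal := (volume.restrict Ω) univ ^ (1 / q.toReal - 1 / (2 : ENNReal).toReal)
  have hqtop : q ≠ ⊤ := ne_top_of_le_ne_top (by simp) hq
  have hK : K ≠ ⊤ := by
    refine ENNReal.rpow_ne_top_of_nonneg ?_ (measure_ne_top _ _)
    rw [sub_nonneg]
    refine one_div_le_one_div_of_le ?_ (ENNReal.toReal_mono (by simp) hq)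
    exact ENNReal.toReal_pos (by rintro rfl; simp at hq1) hqtop
  have hstep : ∀ n, eLpNorm (fun x => Ψ (φ n x)) p (volume.restrict Ω) ≤
      C * (eLpNorm (fun x => Ψ' (f x) • G x) q (volume.restrict Ω) +
        eLpNorm (fun x => Ψ' (φ n x) • gradient (φ n) x - Ψ' (f x) • G x) 2
          (volume.restrict Ω) * K) := fun n => by
    have hcd : ContDiff ℝ 1 Ψ := by
      rw [contDiff_one_iff_deriv]
      refine ⟨fun s => (hΨ s).differentiableAt, ?_⟩
      rwa [show deriv Ψ = Ψ' from funext fun s => (hΨ s).deriv]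
    have hcs : HasCompactSupport (fun x => Ψ (φ n x)) := (hφ n).2.1.comp_left h0
    have hsupp : Function.support (fun x => Ψ (φ n x)) ⊆ Function.support (φ n) := by
      intro x hx
      contrapose! hx
      simp [Function.notMem_support.1 hx, h0]
    have h1 := hC (fun x => Ψ (φ n x)) (hcd.comp ((hφ n).1.of_le (by simp))) hcs
      (hsupp.trans ((subset_tsupport _).trans (hφ n).2.2))
    refine (eLpNorm_restrict_le _ _ _ _).trans (h1.trans ?_)
    gcongr
    have hfs : Function.support (fderiv ℝ fun x => Ψ (φ n x)) ⊆ Ω :=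
      (support_fderiv_subset ℝ).trans ((closure_mono hsupp).trans (hφ n).2.2)
    have hr : eLpNorm (fderiv ℝ fun x => Ψ (φ n x)) q (volume.restrict Ω) =
        eLpNorm (fderiv ℝ fun x => Ψ (φ n x)) q volume :=
      eLpNorm_restrict_eq_of_support_subset (ε := Space N →L[ℝ] ℝ) hfs
    refine hr.ge.trans ?_
    have e : eLpNorm (fderiv ℝ fun x => Ψ (φ n x)) q (volume.restrict Ω) =
        eLpNorm (fun x => Ψ' (φ n x) • gradient (φ n) x) q (volume.restrict Ω) := by
      refine eLpNorm_congr_norm_ae (Eventually.of_forall fun x => ?_)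
      have := ((hΨ (φ n x)).comp_hasFDerivAt x
        (hφ n).differentiable.differentiableAt.hasFDerivAt).fderiv
      rw [show (fun x => Ψ (φ n x)) = Ψ ∘ φ n from rfl, this, norm_smul, norm_smul,
        norm_gradient]
    rw [e]
    have e2 : (fun x => Ψ' (φ n x) • gradient (φ n) x) = (fun x => Ψ' (f x) • G x) +
        fun x => Ψ' (φ n x) • gradient (φ n) x - Ψ' (f x) • G x := by
      funext x; simp
    rw [e2]
    refine (eLpNorm_add_le ((hΨ'.comp_aestronglyMeasurable hfm).smul hG.1) (hsm n) hq1).trans ?_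
    exact add_le_add le_rfl (eLpNorm_le_eLpNorm_mul_rpow_measure_univ hq (hsm n))
  have hlow := Lp.eLpNorm_lim_le_liminf_eLpNorm (p := p) (μ := volume.restrict Ω)
    (f := fun n x => Ψ (φ n x))
    (fun n => (hΨc.comp (hφ n).continuous).aestronglyMeasurable) (fun x => Ψ (f x))
    (by filter_upwards [hae] with x hx using (hΨc.tendsto _).comp hx)
  refine hlow.trans ((liminf_le_liminf (Eventually.of_forall hstep)).trans (le_of_eq ?_))
  refine Tendsto.liminf_eq ?_
  have h3 := ENNReal.Tendsto.mul_const hd (Or.inr hK)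
  have h4 := ENNReal.Tendsto.const_mul (a := (C : ENNReal)) (tendsto_const_nhds
    (x := eLpNorm (fun x => Ψ' (f x) • G x) q (volume.restrict Ω)) |>.add h3)
    (Or.inr ENNReal.coe_ne_top)
  simpa using h4

end Sobolev

/-! ### Consequences of the structure conditions on the coefficients. -/

section CoefficientFacts

variable {a h : ℝ → ℝ}

@[simp] lemma H_zero : H h 0 = 0 := by simp [H]

lemma F_zero (hah : Coefficients a h) : F a h 0 = 0 := by simp [F, hah.a_zero]

lemma Coefficients.hasDerivAt_H (hah : Coefficients a h) {s : ℝ} (hs : 0 < s) :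
    HasDerivAt (H h) (h s) s := by
  have hc : ContinuousAt h s := hah.h_cont.continuousAt (Ioi_mem_nhds hs)
  exact intervalIntegral.integral_hasDerivAt_right (hah.h_int s hs.le)
    (hah.h_cont.stronglyMeasurableAtFilter isOpen_Ioi s hs) hc

lemma Coefficients.continuousOn_H (hah : Coefficients a h) : ContinuousOn (H h) (Ici 0) := by
  intro s hs
  rcases (mem_Ici.1 hs).eq_or_lt with rfl | hs
  · have h1 := intervalIntegral.continuousOn_primitive_interval' (hah.h_int 1 zero_le_one)
      left_mem_uIcc
    rw [uIcc_of_le zero_le_one] at h1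
    exact (h1 0 (by simp)).mono_of_mem_nhdsWithin (Icc_mem_nhdsGE zero_lt_one)
  · exact (hah.hasDerivAt_H hs).continuousAt.continuousWithinAt

lemma Coefficients.strictMonoOn_H (hah : Coefficients a h) : StrictMonoOn (H h) (Ici 0) := by
  refine strictMonoOn_of_deriv_pos (convex_Ici 0) hah.continuousOn_H fun s hs => ?_
  rw [interior_Ici] at hs
  rw [(hah.hasDerivAt_H hs).deriv]
  exact hah.h_pos s hs

lemma Coefficients.H_nonneg (hah : Coefficients a h) {s : ℝ} (hs : 0 ≤ s) : 0 ≤ H h s := by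
  simpa using hah.strictMonoOn_H.monotoneOn (by simp) hs hs

lemma Coefficients.F_nonneg (hah : Coefficients a h) {s : ℝ} (hs : 0 ≤ s) : 0 ≤ F a h s := by
  simpa [F_zero hah] using hah.F_mono (by simp) hs hs

lemma Coefficients.continuousOn_F (hah : Coefficients a h) : ContinuousOn (F a h) (Ici 0) :=
  hah.F_lip.continuousOn

/-- `H` extended by zero to the negative half-line. -/
noncomputable def Hpos (h : ℝ → ℝ) (s : ℝ) : ℝ := H h (max s 0)

/-- `F` extended by zero to the negative half-line. -/
noncomputable def Fpos (a h : ℝ → ℝ) (s : ℝ) : ℝ := F a h (max s 0)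

lemma Hpos_of_nonneg {s : ℝ} (hs : 0 ≤ s) : Hpos h s = H h s := by rw [Hpos, max_eq_left hs]

lemma Fpos_of_nonneg {s : ℝ} (hs : 0 ≤ s) : Fpos a h s = F a h s := by rw [Fpos, max_eq_left hs]

lemma Hpos_of_nonpos {s : ℝ} (hs : s ≤ 0) : Hpos h s = 0 := by rw [Hpos, max_eq_right hs, H_zero]

lemma Coefficients.Fpos_of_nonpos (hah : Coefficients a h) {s : ℝ} (hs : s ≤ 0) :
    Fpos a h s = 0 := by
  rw [Fpos, max_eq_right hs, F_zero hah]

lemma Coefficients.continuous_Hpos (hah : Coefficients a h) : Continuous (Hpos h) :=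
  hah.continuousOn_H.comp_continuous (by fun_prop) fun s => le_max_right s 0

lemma Coefficients.continuous_Fpos (hah : Coefficients a h) : Continuous (Fpos a h) :=
  hah.continuousOn_F.comp_continuous (by fun_prop) fun s => le_max_right s 0

lemma Coefficients.monotone_Hpos (hah : Coefficients a h) : Monotone (Hpos h) := fun _ _ hrs =>
  hah.strictMonoOn_H.monotoneOn (mem_Ici.2 (le_max_right _ _)) (mem_Ici.2 (le_max_right _ _))
    (max_le_max_right 0 hrs)

lemma Coefficients.monotone_Fpos (hah : Coefficients a h) : Monotone (Fpos a h) := fun _ _ hrs =>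
  hah.F_mono (mem_Ici.2 (le_max_right _ _)) (mem_Ici.2 (le_max_right _ _))
    (max_le_max_right 0 hrs)

lemma Coefficients.Hpos_nonneg (hah : Coefficients a h) (s : ℝ) : 0 ≤ Hpos h s :=
  hah.H_nonneg (le_max_right _ _)

lemma Coefficients.Fpos_nonneg (hah : Coefficients a h) (s : ℝ) : 0 ≤ Fpos a h s :=
  hah.F_nonneg (le_max_right _ _)

/-- Integrated form of `LowerStructure`. -/
lemma LowerStructure.mul_sub_le (hah : Coefficients a h) {p₁ q₁ c₃ : ℝ} (hp₁ : 0 < p₁)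
    (hq₁ : 0 < q₁) (hc₃ : 0 < c₃) (hlow : LowerStructure a h p₁ q₁ c₃) {r s : ℝ} (hrs : r ≤ s) :
    c₃ * Hpos h r ^ q₁ * (s - r) ≤
      Hpos h s ^ p₁ * Fpos a h s - Hpos h r ^ p₁ * Fpos a h r := by
  rcases le_total r 0 with hr | hr
  · rw [Hpos_of_nonpos hr, hah.Fpos_of_nonpos hr, Real.zero_rpow hq₁.ne']
    simpa using mul_nonneg (Real.rpow_nonneg (hah.Hpos_nonneg s) _) (hah.Fpos_nonneg s)
  · have hs := hr.trans hrs
    rw [Hpos_of_nonneg hr, Hpos_of_nonneg hs, Fpos_of_nonneg hr, Fpos_of_nonneg hs]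
    -- On `(r, ∞)` the derivative is at least its lower bound at `r`, as `H` is nondecreasing; the
    -- mean value inequality does the rest.
    have hd : ∀ x ∈ Ioi r, ∃ d, HasDerivAt (fun r => H h r ^ p₁ * F a h r) d x ∧
        c₃ * H h r ^ q₁ ≤ d := fun x hx => by
      have hx0 : 0 < x := hr.trans_lt hx
      obtain ⟨d, hd, hd'⟩ := hlow x hx0.le
      refine ⟨d, hd.hasDerivAt (Ici_mem_nhds hx0), le_trans ?_ hd'⟩
      have := hah.H_nonneg hr
      gcongr
      exact hah.strictMonoOn_H.monotoneOn hr hx0.le (le_of_lt hx)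
    refine (convex_Ici r).mul_sub_le_image_sub_of_le_deriv
      (f := fun r => H h r ^ p₁ * F a h r) (C := c₃ * H h r ^ q₁) ?_ ?_ ?_ r (by simp) s hrs hrs
    · have h0 : Ici r ⊆ Ici 0 := Ici_subset_Ici.2 hr
      exact ((hah.continuousOn_H.mono h0).rpow_const fun _ _ => Or.inr hp₁.le).mul
        (hah.continuousOn_F.mono h0)
    · rw [interior_Ici]
      intro x hx
      obtain ⟨d, hd, -⟩ := hd x hx
      exact hd.differentiableAt.differentiableWithinAt
    · rw [interior_Ici]
      intro x hx
      obtain ⟨d, hd, hd'⟩ := hd x hx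
      rwa [hd.deriv]

/-- `H^{γ₁+1}` is of class `C¹`, with derivative bounded by `c₄ H^β`. -/
lemma UpperStructure.exists_deriv (hah : Coefficients a h) {γ₁ β c₄ : ℝ} (hγ₁ : 0 < γ₁)
    (hβ : 0 < β) (hup : UpperStructure h γ₁ β c₄) :
    ∃ Φ' : ℝ → ℝ, Continuous Φ' ∧ (∀ s, HasDerivAt (fun r => Hpos h r ^ (γ₁ + 1)) (Φ' s) s) ∧
      (∀ s, 0 ≤ Φ' s) ∧ (∀ s, Φ' s ≤ c₄ * Hpos h s ^ β) ∧ ∀ s ≤ 0, Φ' s = 0 := by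
  let Φ : ℝ → ℝ := fun r => Hpos h r ^ (γ₁ + 1)
  have hΦmono : Monotone Φ := fun r s hrs =>
    Real.rpow_le_rpow (hah.Hpos_nonneg r) (hah.monotone_Hpos hrs) (by linarith)
  have hpos : ∀ s, 0 < s → HasDerivAt Φ (h s * (γ₁ + 1) * H h s ^ (γ₁ + 1 - 1)) s := fun s hs => by
    refine ((hah.hasDerivAt_H hs).rpow_const (Or.inr (by linarith))).congr_of_eventuallyEq ?_
    filter_upwards [Ioi_mem_nhds hs] with r hr
    simp only [Φ, Hpos_of_nonneg (le_of_lt hr)]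
  have hΦ0 : ∀ s ≤ 0, Φ s = 0 := fun s hs => by
    simp only [Φ, Hpos_of_nonpos hs]; exact Real.zero_rpow (by linarith)
  have hd : ∀ s, ∃ d, HasDerivAt Φ d s ∧ d ≤ c₄ * Hpos h s ^ β ∧ (s ≤ 0 → d = 0) := by
    intro s
    rcases lt_trichotomy s 0 with hs | rfl | hs
    · refine ⟨0, ?_, ?_, fun _ => rfl⟩
      · refine (hasDerivAt_const s (0 : ℝ)).congr_of_eventuallyEq ?_
        filter_upwards [Iio_mem_nhds hs] with r hr using hΦ0 r (le_of_lt hr)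
      · rw [Hpos_of_nonpos hs.le, Real.zero_rpow hβ.ne', mul_zero]
    · obtain ⟨d, hd, hd'⟩ := hup 0 le_rfl
      have hd1 : HasDerivWithinAt Φ d (Ici 0) 0 :=
        hd.congr (fun r hr => by simp only [Φ, Hpos_of_nonneg (mem_Ici.1 hr)])
          (by simp only [Φ, Hpos_of_nonneg le_rfl])
      -- At 0 monotonicity and the upper bound `c₄ H(0)^β = 0` force the one-sided derivative to
      -- vanish, so it glues with the zero extension.
      have hd0 : 0 ≤ d := hd1.nonneg_of_monotoneOn
        ((uniqueDiffOn_Ici (0 : ℝ) 0 (by simp)).accPt) (hΦmono.monotoneOn _)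
      rw [H_zero, Real.zero_rpow hβ.ne', mul_zero] at hd'
      obtain rfl : d = 0 := le_antisymm hd' hd0
      refine ⟨0, ?_, ?_, fun _ => rfl⟩
      · have h2 : HasDerivWithinAt Φ 0 (Iic 0) 0 :=
          (hasDerivWithinAt_const (0 : ℝ) (Iic 0) (0 : ℝ)).congr (fun r hr => hΦ0 r hr)
            (hΦ0 0 le_rfl)
        have := h2.union hd1
        rwa [Iic_union_Ici, hasDerivWithinAt_univ] at this
      · rw [Hpos_of_nonpos le_rfl, Real.zero_rpow hβ.ne', mul_zero]
    · obtain ⟨d, hd, hd'⟩ := hup s hs.le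
      refine ⟨d, ?_, by rwa [Hpos_of_nonneg hs.le], fun h => absurd hs (not_lt.2 h)⟩
      refine (hd.hasDerivAt (Ici_mem_nhds hs)).congr_of_eventuallyEq ?_
      filter_upwards [Ioi_mem_nhds hs] with r hr
      simp only [Φ, Hpos_of_nonneg (le_of_lt hr)]
  choose Φ' h1 h2 h3 using hd
  have hnn : ∀ s, 0 ≤ Φ' s := fun s => by
    rw [← (h1 s).deriv]; exact hΦmono.deriv_nonneg
  refine ⟨Φ', ?_, h1, hnn, h2, h3⟩
  rw [continuous_iff_continuousAt]
  intro s
  rcases le_or_gt s 0 with hs | hs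
  -- Continuity at 0 comes from the squeeze `0 ≤ Φ' ≤ c₄ H^β`; this matters because `h` may be
  -- singular there.
  · have hz : c₄ * Hpos h s ^ β = 0 := by
      rw [Hpos_of_nonpos hs, Real.zero_rpow hβ.ne', mul_zero]
    have hcont : Tendsto (fun r => c₄ * Hpos h r ^ β) (𝓝 s) (𝓝 0) := by
      rw [← hz]
      exact ((hah.continuous_Hpos.rpow_const fun _ => Or.inr hβ.le).const_mul c₄).tendsto s
    rw [ContinuousAt, h3 s hs]
    exact tendsto_of_tendsto_of_tendsto_of_le_of_le tendsto_const_nhds hcont hnn h2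
  · have hc : ContinuousAt (fun s => h s * (γ₁ + 1) * H h s ^ (γ₁ + 1 - 1)) s :=
      ((hah.h_cont.continuousAt (Ioi_mem_nhds hs)).mul_const _).mul
        ((hah.hasDerivAt_H hs).continuousAt.rpow_const (Or.inr (by linarith)))
    refine hc.congr ?_
    filter_upwards [Ioi_mem_nhds hs] with r hr using (hpos r hr).unique (h1 r)

end CoefficientFacts

/-! ### The Sobolev–Hölder bound of the power integral by the weighted energy. -/

section GradientBound

variable {N : ℕ} {Ω : Set (Space N)} {a h : ℝ → ℝ}

/-- Truncation of a `C¹` function that is constant on the negative half-line. -/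
lemma exists_truncation {Φ Φ' : ℝ → ℝ} (hΦ : ∀ s, HasDerivAt Φ (Φ' s) s) (hΦ' : Continuous Φ')
    (hnn : ∀ s, 0 ≤ Φ' s) (hneg : ∀ s ≤ 0, Φ' s = 0) (h0 : Φ 0 = 0) (k : ℝ) :
    ∃ Ψ Ψ' : ℝ → ℝ, (∀ s, HasDerivAt Ψ (Ψ' s) s) ∧ Continuous Ψ' ∧ Ψ 0 = 0 ∧
      (∃ M, ∀ s, |Ψ' s| ≤ M) ∧ (∀ s, 0 ≤ Ψ' s ∧ Ψ' s ≤ Φ' s) ∧ (∀ s, k + 1 ≤ s → Ψ' s = 0) ∧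
      ∀ s, Φ (min s k) ≤ Ψ s := by
  -- Cutting off the derivative instead of the function keeps `Ψ` of class `C¹` with bounded
  -- derivative, below `Φ'`, and leaves `Φ` unchanged up to `k`.
  let η : ℝ → ℝ := fun s => max 0 (min 1 (k + 1 - s))
  have hη : Continuous η := by fun_prop
  have hη0 : ∀ s, 0 ≤ η s := fun s => le_max_left _ _
  have hη1 : ∀ s, η s ≤ 1 := fun s => max_le zero_le_one (min_le_left _ _)
  let Ψ' : ℝ → ℝ := fun s => Φ' s * η s
  have hΨ'c : Continuous Ψ' := hΦ'.mul hη
  let Ψ : ℝ → ℝ := fun s => ∫ r in (0 : ℝ)..s, Ψ' r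
  have hΨ : ∀ s, HasDerivAt Ψ (Ψ' s) s := fun s =>
    (hΨ'c.integral_hasStrictDerivAt 0 s).hasDerivAt
  have hΨ'0 : ∀ s, 0 ≤ Ψ' s := fun s => mul_nonneg (hnn s) (hη0 s)
  have hout : ∀ s, k + 1 ≤ s → Ψ' s = 0 := fun s hs => by
    have : η s = 0 := max_eq_left ((min_le_right _ _).trans (by linarith))
    simp [Ψ', this]
  have hmono : Monotone Ψ := monotone_of_deriv_nonneg (fun s => (hΨ s).differentiableAt)
    fun s => by rw [(hΨ s).deriv]; exact hΨ'0 s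
  refine ⟨Ψ, Ψ', hΨ, hΨ'c, by simp [Ψ], ?_,
    fun s => ⟨hΨ'0 s, mul_le_of_le_one_right (hnn s) (hη1 s)⟩, hout, fun s => ?_⟩
  · obtain ⟨M, hM⟩ := (isCompact_Icc (a := (0 : ℝ)) (b := k + 1)).exists_bound_of_continuousOn
      hΨ'c.continuousOn
    refine ⟨max M 0, fun s => ?_⟩
    by_cases hs : s ∈ Icc 0 (k + 1)
    · exact (hM s hs).trans (le_max_left _ _)
    · have : Ψ' s = 0 := by
        rw [mem_Icc, not_and_or, not_le, not_le] at hs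
        rcases hs with hs | hs
        · simp [Ψ', hneg s hs.le]
        · exact hout s hs.le
      simp [this]
  · refine le_trans (le_of_eq ?_) (hmono (min_le_left s k))
    have h1 : ∫ r in (0 : ℝ)..(min s k), Ψ' r = ∫ r in (0 : ℝ)..(min s k), Φ' r := by
      refine intervalIntegral.integral_congr fun r hr => ?_
      rcases le_total 0 (min s k) with h | h
      · rw [uIcc_of_le h] at hr
        have hrk : r ≤ k := hr.2.trans (min_le_right _ _)
        have : η r = 1 := by
          simp only [η]
          rw [min_eq_left (by linarith), max_eq_right zero_le_one]
        simp [Ψ', this]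
      · rw [uIcc_of_ge h] at hr
        simp [Ψ', hneg r hr.2]
    simp only [Ψ]
    rw [h1, intervalIntegral.integral_eq_sub_of_hasDerivAt (fun r _ => hΦ r)
      (hΦ'.intervalIntegrable _ _), h0, sub_zero]

lemma eLpNorm_ofReal_eq {α : Type*} [MeasurableSpace α] {μ : Measure α} {f : α → ℝ}
    (hf0 : ∀ x, 0 ≤ f x) {p : ℝ} (hp : 0 < p) (hf : MemLp f (ENNReal.ofReal p) μ) :
    eLpNorm f (ENNReal.ofReal p) μ = ENNReal.ofReal ((∫ x, f x ^ p ∂μ) ^ p⁻¹) := by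
  rw [hf.eLpNorm_eq_integral_rpow_norm (by simpa using hp) (by simp),
    ENNReal.toReal_ofReal hp.le]
  simp only [Real.norm_of_nonneg (hf0 _)]

/-- The Sobolev inequality combined with Hölder's inequality. -/
lemma IsW012.gradient_bound (hah : Coefficients a h) (hN : 1 ≤ N)
    (hΩb : Bornology.IsBounded Ω) {p₁ γ₁ β c₄ q₁ δ₁ δ₂ p₀ : ℝ} (hp₁ : 0 < p₁) (hγ₁ : 0 < γ₁)
    (hβ : 0 < β) (hc₄ : 0 < c₄) (hq₁ : 0 < q₁)
    (hup : UpperStructure h γ₁ β c₄) (hβq : q₁ / 2 < β) (hδ₁ : δ₁ = delta1 p₁ γ₁)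
    (hδ₁_one : 1 ≤ δ₁) (hδ₁_two : δ₁ < 2) (hδ₂ : δ₂ = delta2 N δ₁) (hp₀ : p₀ = expP0 β q₁ δ₂) :
    ∃ D : ℝ, 0 < D ∧ ∀ (f : Space N → ℝ) (G : Space N → Space N), IsW012 Ω f G →
      IntegrableOn (fun x => Hpos h (f x) ^ p₀) Ω → ∀ k : ℝ,
      (∫ x in Ω, Hpos h (min (f x) k) ^ (p₁ + 1)) ^ (2 / δ₁) ≤
        D * (∫ x in Ω, Hpos h (f x) ^ p₀) ^ ((2 - δ₂) / δ₂) *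
          ∫ x in Ω, (Iic (k + 1)).indicator (fun s => Hpos h s ^ q₁) (f x) * ‖G x‖ ^ 2 := by
  obtain ⟨C, hC⟩ := exists_sobolev_const (Ω := Ω) hN hΩb hδ₁_one hδ₁_two
  obtain ⟨hd1, hd2⟩ := delta2_pos hN hδ₁_one hδ₁_two
  rw [← hδ₂] at hd1 hd2 hC
  obtain ⟨Φ', hΦ'c, hΦ, hΦnn, hΦle, hΦneg⟩ := hup.exists_deriv hah hγ₁ hβ
  have hfin : IsFiniteMeasure (volume.restrict Ω) :=
    ⟨by simpa using hΩb.measure_lt_top⟩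
  have hHc := hah.continuous_Hpos
  have hHnn := hah.Hpos_nonneg
  -- The summand 1 keeps the constant positive even if the Sobolev constant is 0; the square comes
  -- from squaring the norm inequality at the end.
  refine ⟨((C : ℝ) * c₄ + 1) ^ 2, by positivity, fun f G hf hZ k => ?_⟩
  have hfm := hf.1.1
  have hG := hf.2.1
  obtain ⟨Ψ, Ψ', hΨ, hΨ'c, hΨ0, ⟨M, hM⟩, hΨΦ, hΨout, hΨge⟩ := exists_truncation hΦ hΦ'c hΦnn hΦneg
    (by rw [Hpos_of_nonpos le_rfl]; exact Real.zero_rpow (by linarith)) k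
  -- The Hölder partner of 2 for `δ₂`, that is `1/r + 1/2 = 1/δ₂`; the exponent `p₀` is chosen so
  -- that `A ^ r = H^{p₀}`.
  set r : ℝ := 2 * δ₂ / (2 - δ₂) with hr
  have hr0 : 0 < r := by have : 0 < 2 - δ₂ := by linarith
                         positivity
  have hp₀r : (β - q₁ / 2) * r = p₀ := by rw [hp₀, expP0]
  have hsob := hf.sobolev_comp hΩb (p := ENNReal.ofReal δ₁) (q := ENNReal.ofReal δ₂)
    (by rw [← ENNReal.ofReal_ofNat]; exact ENNReal.ofReal_le_ofReal hd2.le)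
    (by simpa using hd1) hC hΨ hΨ'c hΨ0 hM
  -- the left-hand side
  let X : Space N → ℝ := fun x => Hpos h (min (f x) k) ^ (γ₁ + 1)
  have hXm : AEStronglyMeasurable X (volume.restrict Ω) := by
    have hc : Continuous fun s => Hpos h (min s k) ^ (γ₁ + 1) :=
      (hHc.comp (continuous_id.min continuous_const)).rpow_const fun _ => Or.inr (by linarith)
    exact hc.comp_aestronglyMeasurable hfm
  have hX0 : ∀ x, 0 ≤ X x := fun x => Real.rpow_nonneg (hHnn _) _
  have hXL : MemLp X (ENNReal.ofReal δ₁) (volume.restrict Ω) := by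
    refine MemLp.of_bound hXm (Hpos h k ^ (γ₁ + 1)) (Eventually.of_forall fun x => ?_)
    rw [Real.norm_of_nonneg (hX0 x)]
    exact Real.rpow_le_rpow (hHnn _) (hah.monotone_Hpos (min_le_right _ _)) (by linarith)
  have hXpow : ∀ x, X x ^ δ₁ = Hpos h (min (f x) k) ^ (p₁ + 1) := fun x => by
    simp only [X]
    rw [← Real.rpow_mul (hHnn _), hδ₁, delta1]
    congr 1
    field_simp
  have hXle : eLpNorm X (ENNReal.ofReal δ₁) (volume.restrict Ω) ≤
      eLpNorm (fun x => Ψ (f x)) (ENNReal.ofReal δ₁) (volume.restrict Ω) := by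
    refine eLpNorm_mono_real fun x => ?_
    rw [Real.norm_of_nonneg (hX0 x)]
    exact hΨge _
  -- the right-hand side
  let A : Space N → ℝ := fun x => Hpos h (f x) ^ (β - q₁ / 2)
  let B : Space N → ℝ := fun x =>
    (Iic (k + 1)).indicator (fun s => Hpos h s ^ (q₁ / 2)) (f x) * ‖G x‖
  have hA0 : ∀ x, 0 ≤ A x := fun x => Real.rpow_nonneg (hHnn _) _
  have hB0 : ∀ x, 0 ≤ B x := fun x =>
    mul_nonneg (indicator_nonneg (fun s _ => Real.rpow_nonneg (hHnn _) _) _) (norm_nonneg _)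
  have hAm : AEStronglyMeasurable A (volume.restrict Ω) :=
    (hHc.rpow_const fun _ => Or.inr (by linarith)).comp_aestronglyMeasurable hfm
  have hApow : ∀ x, A x ^ r = Hpos h (f x) ^ p₀ := fun x => by
    simp only [A]
    rw [← Real.rpow_mul (hHnn _), hp₀r]
  have hAL : MemLp A (ENNReal.ofReal r) (volume.restrict Ω) := by
    refine (integrable_norm_rpow_iff hAm (by simpa using hr0) (by simp)).1 ?_
    rw [ENNReal.toReal_ofReal hr0.le]
    simp only [Real.norm_of_nonneg (hA0 _), hApow]
    exact hZ
  have hBL : MemLp B (ENNReal.ofReal 2) (volume.restrict Ω) := by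
    have hm : Measurable ((Iic (k + 1)).indicator (fun s => Hpos h s ^ (q₁ / 2))) :=
      (hHc.rpow_const fun _ => Or.inr (by linarith)).measurable.indicator measurableSet_Iic
    have hG2 : MemLp (fun x => ‖G x‖) (ENNReal.ofReal 2) (volume.restrict Ω) := by
      simpa using hG.norm
    refine MemLp.of_le_mul (c := Hpos h (k + 1) ^ (q₁ / 2)) hG2
      ((hm.comp_aemeasurable hfm.aemeasurable).aestronglyMeasurable.mul hG.1.norm)
      (Eventually.of_forall fun x => ?_)
    rw [Real.norm_of_nonneg (hB0 x), norm_norm]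
    refine mul_le_mul_of_nonneg_right ?_ (norm_nonneg _)
    by_cases hx : f x ∈ Iic (k + 1)
    · rw [indicator_of_mem hx]
      exact Real.rpow_le_rpow (hHnn _) (hah.monotone_Hpos hx) (by linarith)
    · rw [indicator_of_notMem hx]; exact Real.rpow_nonneg (hHnn _) _
  have hBpow : ∀ x, B x ^ (2 : ℝ) =
      (Iic (k + 1)).indicator (fun s => Hpos h s ^ q₁) (f x) * ‖G x‖ ^ 2 := fun x => by
    simp only [B]
    rw [Real.rpow_two, mul_pow]
    congr 1
    by_cases hx : f x ∈ Iic (k + 1)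
    · rw [indicator_of_mem hx, indicator_of_mem hx, ← Real.rpow_mul_natCast (hHnn _)]
      congr 1; push_cast; ring
    · rw [indicator_of_notMem hx, indicator_of_notMem hx]; simp
  have hAB : eLpNorm (fun x => Ψ' (f x) • G x) (ENNReal.ofReal δ₂) (volume.restrict Ω) ≤
      ENNReal.ofReal c₄ * (eLpNorm A (ENNReal.ofReal r) (volume.restrict Ω) *
        eLpNorm B (ENNReal.ofReal 2) (volume.restrict Ω)) := by
    have htriple : Real.HolderTriple r 2 δ₂ := by
      refine ⟨?_, hr0, by norm_num⟩
      rw [hr]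
      have : 2 - δ₂ ≠ 0 := by linarith
      field_simp
      ring
    have := htriple.ennrealOfReal
    refine le_trans (eLpNorm_le_mul_eLpNorm_of_ae_le_mul (g := A • B)
      (Eventually.of_forall fun x => ?_) _)
      (mul_le_mul_right (eLpNorm_smul_le_mul_eLpNorm hBL.1 hAL.1) _)
    simp only [Pi.smul_apply', smul_eq_mul]
    rw [Real.norm_of_nonneg (mul_nonneg (hA0 x) (hB0 x)), norm_smul,
      Real.norm_of_nonneg (hΨΦ _).1]
    simp only [A, B]
    by_cases hx : f x ∈ Iic (k + 1)
    · rw [indicator_of_mem hx, ← mul_assoc, ← mul_assoc]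
      refine mul_le_mul_of_nonneg_right ?_ (norm_nonneg _)
      refine ((hΨΦ _).2.trans (hΦle _)).trans (le_of_eq ?_)
      rw [mul_assoc, ← Real.rpow_add_of_nonneg (hHnn _) (by linarith) (by linarith)]
      congr 2; ring
    · rw [indicator_of_notMem hx, hΨout _ (le_of_lt (not_le.1 hx))]
      simp
  have hall := hXle.trans (hsob.trans (mul_le_mul_right hAB _))
  rw [eLpNorm_ofReal_eq hX0 (by linarith) hXL, eLpNorm_ofReal_eq hA0 hr0 hAL,
    eLpNorm_ofReal_eq hB0 (by norm_num) hBL] at hall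
  simp only [hXpow, hApow, hBpow] at hall
  set x := ∫ x in Ω, Hpos h (min (f x) k) ^ (p₁ + 1)
  set z := ∫ x in Ω, Hpos h (f x) ^ p₀
  set e := ∫ x in Ω, (Iic (k + 1)).indicator (fun s => Hpos h s ^ q₁) (f x) * ‖G x‖ ^ 2
  have hx0 : 0 ≤ x := integral_nonneg fun _ => Real.rpow_nonneg (hHnn _) _
  have hz0 : 0 ≤ z := integral_nonneg fun _ => Real.rpow_nonneg (hHnn _) _
  have he0 : 0 ≤ e := integral_nonneg fun _ =>
    mul_nonneg (indicator_nonneg (fun s _ => Real.rpow_nonneg (hHnn _) _) _) (sq_nonneg _)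
  have hC0 : (C : ENNReal) = ENNReal.ofReal (C : ℝ) := by simp
  rw [hC0, ← ENNReal.ofReal_mul (by positivity), ← ENNReal.ofReal_mul (by positivity),
    ← ENNReal.ofReal_mul (by positivity), ENNReal.ofReal_le_ofReal_iff (by positivity)] at hall
  have hsq : (x ^ δ₁⁻¹) ^ 2 ≤ (((C : ℝ) * c₄ + 1) * (z ^ r⁻¹ * e ^ (2 : ℝ)⁻¹)) ^ 2 := by
    refine pow_le_pow_left₀ (by positivity) (hall.trans ?_) 2
    rw [← mul_assoc]
    refine mul_le_mul_of_nonneg_right (by linarith) (by positivity)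
  rw [← Real.rpow_mul_natCast hx0, mul_pow, mul_pow, ← Real.rpow_mul_natCast hz0,
    ← Real.rpow_mul_natCast he0] at hsq
  rw [show δ₁⁻¹ * ((2 : ℕ) : ℝ) = 2 / δ₁ by push_cast; field_simp,
    show r⁻¹ * ((2 : ℕ) : ℝ) = (2 - δ₂) / δ₂ by push_cast; rw [hr]; field_simp,
    show (2 : ℝ)⁻¹ * ((2 : ℕ) : ℝ) = 1 by push_cast; norm_num, Real.rpow_one, ← mul_assoc] at hsq
  exact hsq

/-- Weights `b(H) F` with `b` continuous, monotone and nonnegative are admissible. -/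
lemma Coefficients.weight (hah : Coefficients a h) {b : ℝ → ℝ} (hb : Continuous b)
    (hbm : Monotone b) (hb0 : ∀ s, 0 ≤ b s) :
    Continuous (fun s => b (Hpos h s) * Fpos a h s) ∧
      Monotone (fun s => b (Hpos h s) * Fpos a h s) ∧
      ∀ s ≤ 0, b (Hpos h s) * Fpos a h s = 0 :=
  ⟨(hb.comp hah.continuous_Hpos).mul hah.continuous_Fpos,
    fun _ _ hrs => mul_le_mul (hbm (hah.monotone_Hpos hrs)) (hah.monotone_Fpos hrs)
      (hah.Fpos_nonneg _) (hb0 _),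
    fun s hs => by rw [hah.Fpos_of_nonpos hs, mul_zero]⟩

end GradientBound

/-! ### Chain rule in time and the energy identity. -/

section TimeIntegral

lemma _root_.AbsolutelyContinuousOnInterval.lipschitz_comp {f j : ℝ → ℝ} {a b : ℝ} {K : NNReal}
    (hj : LipschitzWith K j) (hf : AbsolutelyContinuousOnInterval f a b) :
    AbsolutelyContinuousOnInterval (fun x => j (f x)) a b := by
  have h0 : Tendsto (fun E : ℕ × (ℕ → ℝ × ℝ) => (K : ℝ) *
      ∑ i ∈ Finset.range E.1, dist (f (E.2 i).1) (f (E.2 i).2))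
      (AbsolutelyContinuousOnInterval.totalLengthFilter ⊓
        𝓟 (AbsolutelyContinuousOnInterval.disjWithin a b)) (𝓝 0) := by
    simpa using Tendsto.const_mul (K : ℝ) hf
  refine squeeze_zero (fun E => Finset.sum_nonneg fun _ _ => dist_nonneg) (fun E => ?_) h0
  rw [Finset.mul_sum]
  exact Finset.sum_le_sum fun i _ => hj.dist_le_mul _ _

variable {α : Type*} [MeasurableSpace α] {μ : Measure α} [IsFiniteMeasure μ]

/-- Chain rule for a primitive of an integrable function. -/
lemma primitive_comp_sub {b : ℝ → ℝ} (hb : Continuous b) {B : ℝ} (hB : ∀ s, |b s| ≤ B)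
    {g : ℝ → ℝ} {t₀ s t c : ℝ} (hs : t₀ ≤ s) (hst : s ≤ t)
    (hg : IntervalIntegrable g volume t₀ t) :
    (∫ r in (0 : ℝ)..(c + ∫ τ in t₀..t, g τ), b r) - (∫ r in (0 : ℝ)..(c + ∫ τ in t₀..s, g τ), b r)
      = ∫ τ in s..t, b (c + ∫ σ in t₀..τ, g σ) * g τ := by
  let j : ℝ → ℝ := fun v => ∫ r in (0 : ℝ)..v, b r
  have hj : ∀ v, HasDerivAt j (b v) v := fun v => (hb.integral_hasStrictDerivAt 0 v).hasDerivAt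
  -- Boundedness of `b` makes its primitive Lipschitz, so composing with the absolutely continuous
  -- path stays absolutely continuous and the almost everywhere chain rule integrates.
  have hjL : LipschitzWith (B.toNNReal) j := by
    refine lipschitzWith_of_nnnorm_deriv_le (fun v => (hj v).differentiableAt) fun v => ?_
    rw [(hj v).deriv, ← NNReal.coe_le_coe, coe_nnnorm]
    exact (hB v).trans (Real.le_coe_toNNReal B)
  have ht0 : t₀ ≤ t := hs.trans hst
  have hU : AbsolutelyContinuousOnInterval (fun τ => c + ∫ σ in t₀..τ, g σ) t₀ t :=
    ((LipschitzWith.const c).lipschitzOnWith.absolutelyContinuousOnInterval).add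
      (hg.absolutelyContinuousOnInterval_intervalIntegral left_mem_uIcc)
  have hsub : uIcc s t ⊆ uIcc t₀ t := by
    rw [uIcc_of_le hst, uIcc_of_le ht0]; exact Icc_subset_Icc_left hs
  have hjU := (hU.lipschitz_comp hjL).mono hsub
  have h1 := hjU.integral_deriv_eq_sub
  change j _ - j _ = _
  rw [← h1]
  refine intervalIntegral.integral_congr_ae ?_
  filter_upwards [hg.ae_hasDerivAt_integral] with τ hτ hmem
  have hτ' := hτ (hsub (uIoc_subset_uIcc hmem)) t₀ left_mem_uIcc
  exact ((hj _).comp τ (hτ'.const_add c)).deriv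

lemma ae_memLp_two_section {ν : Measure ℝ} [SFinite ν] {g : ℝ → α → ℝ}
    (hg : MemLp (fun z : ℝ × α => g z.1 z.2) 2 (ν.prod μ)) : ∀ᵐ t ∂ν, MemLp (g t) 2 μ := by
  filter_upwards [hg.integrable_sq.prod_right_ae, hg.1.prodMk_left] with t ht ht'
  exact (memLp_two_iff_integrable_sq ht').2 ht

/-- Energy identity for `∫ j(V(t))`, `j' = b`, along a path `V(t) = v₀ + ∫ g`. -/
lemma energy_identity {t₀ : ℝ} {V g : ℝ → α → ℝ} {v₀ : α → ℝ}
    (hg : MemLp (fun z : ℝ × α => g z.1 z.2) 2 ((volume.restrict (Ioi t₀)).prod μ))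
    (hv₀ : Integrable v₀ μ)
    (hV : ∀ t, t₀ ≤ t → ∀ᵐ x ∂μ, V t x = v₀ x + ∫ s in t₀..t, g s x) :
    (∀ t, t₀ ≤ t → Integrable (V t) μ) ∧
    ∀ b : ℝ → ℝ, Continuous b → (∃ B, ∀ s, |b s| ≤ B) → ∀ T, t₀ ≤ T →
      IntervalIntegrable (fun τ => ∫ x, b (V τ x) * g τ x ∂μ) volume t₀ T ∧
      ∀ s t, t₀ ≤ s → s ≤ t → t ≤ T →
        (∫ x, (∫ r in (0 : ℝ)..V t x, b r) ∂μ) - (∫ x, (∫ r in (0 : ℝ)..V s x, b r) ∂μ) =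
          ∫ τ in s..t, ∫ x, b (V τ x) * g τ x ∂μ := by
  let g' : ℝ × α → ℝ := hg.1.mk
  have hg'm : StronglyMeasurable g' := hg.1.stronglyMeasurable_mk
  have hgg' : ∀ᵐ z ∂((volume.restrict (Ioi t₀)).prod μ), g z.1 z.2 = g' z := hg.1.ae_eq_mk
  have hg'L : MemLp g' 2 ((volume.restrict (Ioi t₀)).prod μ) := hg.ae_eq hgg'
  have hg'I : ∀ T, Integrable g' ((volume.restrict (Ioc t₀ T)).prod μ) := fun T => by
    refine MemLp.integrable (q := 2) (by norm_num) (hg'L.mono_measure ?_)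
    exact Measure.prod_mono (Measure.restrict_mono Ioc_subset_Ioi_self le_rfl) le_rfl
  have hae1 : ∀ᵐ t ∂(volume.restrict (Ioi t₀)), ∀ᵐ x ∂μ, g t x = g' (t, x) :=
    Measure.ae_ae_of_ae_prod hgg'
  have hae2 : ∀ᵐ x ∂μ, ∀ᵐ t ∂(volume.restrict (Ioi t₀)), g t x = g' (t, x) := by
    have h1 : ∀ᵐ z ∂(μ.prod (volume.restrict (Ioi t₀))), g z.2 z.1 = g' (z.2, z.1) :=
      Measure.measurePreserving_swap.quasiMeasurePreserving.ae hgg'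
    exact Measure.ae_ae_of_ae_prod h1
  let v₀' : α → ℝ := hv₀.1.mk
  have hv₀'m : StronglyMeasurable v₀' := hv₀.1.stronglyMeasurable_mk
  have hvv : ∀ᵐ x ∂μ, v₀ x = v₀' x := hv₀.1.ae_eq_mk
  -- `V` is prescribed only up to a null set for each `t`, which says nothing about joint
  -- measurability. `U` is a jointly measurable version, to which Fubini applies; writing the upper
  -- limit as an indicator makes the parametric integral measurable.
  let U : ℝ × α → ℝ := fun z => v₀' z.2 + ∫ s, (Ioc t₀ z.1).indicator (fun s => g' (s, z.2)) s
  have hUm : StronglyMeasurable U := by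
    refine (hv₀'m.comp_measurable measurable_snd).add ?_
    have hset : MeasurableSet {q : (ℝ × α) × ℝ | q.2 ∈ Ioc t₀ q.1.1} := by
      have e : {q : (ℝ × α) × ℝ | q.2 ∈ Ioc t₀ q.1.1} =
          {q | t₀ < q.2} ∩ {q | q.2 ≤ q.1.1} := rfl
      rw [e]
      exact (measurableSet_lt measurable_const measurable_snd).inter
        (measurableSet_le measurable_snd (measurable_fst.comp measurable_fst))
    have hm : StronglyMeasurable (fun q : (ℝ × α) × ℝ => g' (q.2, q.1.2)) :=
      hg'm.comp_measurable (measurable_snd.prodMk (measurable_snd.comp measurable_fst))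
    exact (hm.indicator hset).integral_prod_right' (ν := volume)
  have hU : ∀ t, t₀ ≤ t → ∀ x, U (t, x) = v₀' x + ∫ s in t₀..t, g' (s, x) := fun t ht x => by
    simp only [U]
    rw [integral_indicator measurableSet_Ioc, intervalIntegral.integral_of_le ht]
  have hVU : ∀ t, t₀ ≤ t → ∀ᵐ x ∂μ, V t x = U (t, x) := fun t ht => by
    filter_upwards [hV t ht, hvv, hae2] with x h1 h2 h3
    rw [h1, h2, hU t ht]
    congr 1
    rw [intervalIntegral.integral_of_le ht, intervalIntegral.integral_of_le ht]
    exact integral_congr_ae (ae_restrict_of_ae_restrict_of_subset Ioc_subset_Ioi_self h3)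
  have hUint : ∀ t, t₀ ≤ t → Integrable (fun x => U (t, x)) μ := fun t ht => by
    have h1 : Integrable (fun x => ∫ s in t₀..t, g' (s, x)) μ := by
      simp only [intervalIntegral.integral_of_le ht]
      exact (hg'I t).integral_prod_right
    exact ((hv₀.congr hvv).add h1).congr (Eventually.of_forall fun x => (hU t ht x).symm)
  refine ⟨fun t ht => (hUint t ht).congr ((hVU t ht).mono fun x hx => hx.symm), ?_⟩
  rintro b hb ⟨B, hB⟩ T hT
  have hbU : ∀ T, Integrable (fun z => b (U z) * g' z) ((volume.restrict (Ioc t₀ T)).prod μ) :=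
    fun T => (hg'I T).bdd_mul (hb.comp_stronglyMeasurable hUm).aestronglyMeasurable
      (Eventually.of_forall fun z => hB _)
  have hA : ∀ᵐ τ ∂(volume.restrict (Ioi t₀)), (∫ x, b (U (τ, x)) * g' (τ, x) ∂μ) =
      ∫ x, b (V τ x) * g τ x ∂μ := by
    filter_upwards [hae1, ae_restrict_mem measurableSet_Ioi] with τ h1 h2
    refine integral_congr_ae ?_
    filter_upwards [h1, hVU τ (le_of_lt h2)] with x h3 h4
    rw [h3, h4]
  constructor
  · rw [intervalIntegrable_iff_integrableOn_Ioc_of_le hT]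
    exact (hbU T).integral_prod_left.congr
      (ae_restrict_of_ae_restrict_of_subset Ioc_subset_Ioi_self hA)
  · intro s t hs hst htT
    have ht0 := hs.trans hst
    let j : ℝ → ℝ := fun v => ∫ r in (0 : ℝ)..v, b r
    have hjd : ∀ v, HasDerivAt j (b v) v := fun v =>
      (hb.integral_hasStrictDerivAt 0 v).hasDerivAt
    have hjc : Continuous j := continuous_iff_continuousAt.2 fun v => (hjd v).continuousAt
    have hjle : ∀ v, ‖j v‖ ≤ B * ‖v‖ := fun v => by
      have := intervalIntegral.norm_integral_le_of_norm_le_const (a := 0) (b := v) (f := b)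
        (C := B) (fun x _ => hB x)
      simpa using this
    have hji : ∀ t, t₀ ≤ t → Integrable (fun x => j (U (t, x))) μ := fun t ht =>
      ((hUint t ht).norm.const_mul B).mono'
        (hjc.comp_aestronglyMeasurable (hUint t ht).1) (Eventually.of_forall fun x => hjle _)
    have hjV : ∀ t, t₀ ≤ t → ∫ x, j (V t x) ∂μ = ∫ x, j (U (t, x)) ∂μ := fun t ht =>
      integral_congr_ae ((hVU t ht).mono fun x hx => by simp only [hx])
    change (∫ x, j (V t x) ∂μ) - (∫ x, j (V s x) ∂μ) = _
    rw [hjV t ht0, hjV s hs, ← integral_sub (hji t ht0) (hji s hs)]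
    have hx : ∀ᵐ x ∂μ, j (U (t, x)) - j (U (s, x)) = ∫ τ in Ioc s t, b (U (τ, x)) * g' (τ, x) := by
      filter_upwards [(hg'I t).prod_left_ae] with x hx
      have hI : IntervalIntegrable (fun τ => g' (τ, x)) volume t₀ t :=
        (intervalIntegrable_iff_integrableOn_Ioc_of_le ht0).2 hx
      have h1 := primitive_comp_sub hb hB (c := v₀' x) hs hst hI
      rw [hU t ht0, hU s hs]
      refine h1.trans ?_
      rw [intervalIntegral.integral_of_le hst]
      refine setIntegral_congr_fun measurableSet_Ioc fun τ hτ => ?_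
      rw [hU τ (hs.trans hτ.1.le)]
    rw [integral_congr_ae hx, intervalIntegral.integral_of_le hst,
      integral_integral_swap (f := fun x τ => b (U (τ, x)) * g' (τ, x))]
    · refine integral_congr_ae (ae_restrict_of_ae_restrict_of_subset (fun τ hτ => ?_) hA)
      exact hs.trans_lt hτ.1
    · have h1 : Integrable (fun z => b (U z) * g' z) ((volume.restrict (Ioc s t)).prod μ) :=
        (hbU t).mono_measure (Measure.prod_mono
          (Measure.restrict_mono (Ioc_subset_Ioc_left hs) le_rfl) le_rfl)
      exact h1.swap

end TimeIntegral

/-! ### Energy inequality for solutions; truncated power weights. -/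

section Energy

variable {N : ℕ} {Ω : Set (Space N)} {a h : ℝ → ℝ} {t₀ : ℝ} {u₀ : Space N → ℝ}
  {u : ℝ → Space N → ℝ}

/-- `A b` is the density of the energy `∫ j(H(u))`, `j' = b`, and satisfies the energy inequality
for all weights `b` that are continuous, monotone, nonnegative and bounded. -/
structure EnergyDensity (Ω : Set (Space N)) (a h : ℝ → ℝ) (t₀ : ℝ) (u : ℝ → Space N → ℝ)
    (G : ℝ → Space N → Space N) (A : (ℝ → ℝ) → ℝ → ℝ) : Prop where
  integrable : ∀ t, t₀ ≤ t → Integrable (fun x => Hpos h (u t x)) (volume.restrict Ω)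
  isW012 : ∀ᵐ t ∂(volume.restrict (Ioi t₀)), IsW012 Ω (u t) (G t)
  sub : ∀ b b' : ℝ → ℝ, Continuous b → Continuous b' → (∃ B, ∀ s, |b s| ≤ B) →
    (∃ B, ∀ s, |b' s| ≤ B) → ∀ᵐ t ∂(volume.restrict (Ioi t₀)),
      A (fun s => b' s - b s) t = A b' t - A b t
  intervalIntegrable : ∀ b : ℝ → ℝ, Continuous b → (∃ B, ∀ s, |b s| ≤ B) →
    ∀ T, t₀ ≤ T → IntervalIntegrable (A b) volume t₀ T
  identity : ∀ b : ℝ → ℝ, Continuous b → (∃ B, ∀ s, |b s| ≤ B) → ∀ s t, t₀ ≤ s → s ≤ t →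
    (∫ x in Ω, ∫ r in (0 : ℝ)..Hpos h (u t x), b r) -
      (∫ x in Ω, ∫ r in (0 : ℝ)..Hpos h (u s x), b r) = ∫ τ in s..t, A b τ
  le : ∀ b : ℝ → ℝ, Continuous b → Monotone b → (∀ s, 0 ≤ b s) → (∃ B, ∀ s, |b s| ≤ B) →
    ∀ (κ : ℝ → ℝ) (k : ℝ), Continuous κ → (∀ s, 0 ≤ κ s) →
      (∀ r s, r ≤ s → s ≤ k → κ r * (s - r) ≤
        b (Hpos h s) * Fpos a h s - b (Hpos h r) * Fpos a h r) →
      ∀ᵐ t ∂(volume.restrict (Ioi t₀)),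
        A b t ≤ -∫ x in Ω, (Iic k).indicator κ (u t x) * ‖G t x‖ ^ 2

/-- The density is `∫ b(H(u)) [H(u)]_t`. Multiplying the differential inequality by `b(H(u)) ≥ 0`
replaces `[H(u)]_t` by `F(u) Δu`, and `HasWeakDiv.energy_le` applies to the weight `b(H) F`, a
product of nonnegative nondecreasing functions. The later arguments use only the resulting
structure. -/
lemma IsSolution.exists_energyDensity (hΩb : Bornology.IsBounded Ω) (hah : Coefficients a h)
    (hu : IsSolution Ω a h t₀ u₀ u)
    (hu₀ : Integrable (fun x => H h (u₀ x)) (volume.restrict Ω)) :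
    ∃ (G : ℝ → Space N → Space N) (A : (ℝ → ℝ) → ℝ → ℝ), EnergyDensity Ω a h t₀ u G A := by
  obtain ⟨v_t, Lap, hvt, hpath, hweak, hFL, hineq⟩ := hu.equation
  have hprod : (volume : Measure (ℝ × Space N)).restrict (Ioi t₀ ×ˢ Ω) =
      (volume.restrict (Ioi t₀)).prod (volume.restrict Ω) := by
    rw [Measure.volume_eq_prod, Measure.prod_restrict]
  rw [hprod] at hvt hFL hineq
  have hfin : IsFiniteMeasure (volume.restrict Ω) :=
    ⟨by simpa using hΩb.measure_lt_top⟩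
  have hHu : ∀ t, t₀ ≤ t → ∀ᵐ x ∂(volume.restrict Ω), Hpos h (u t x) = H h (u t x) :=
    fun t ht => (hu.nonneg t ht).mono fun x hx => Hpos_of_nonneg hx
  obtain ⟨hVint, hen⟩ := energy_identity (V := fun t x => Hpos h (u t x)) hvt hu₀
    (fun t ht => by
      filter_upwards [hHu t ht, hpath t ht] with x h1 h2
      rw [h1, h2])
  -- A weak gradient exists only for almost every time; at the exceptional times the choice is
  -- arbitrary.
  have hex : ∀ t, ∃ G, t ∈ {t | ∃ G, IsW012 Ω (u t) G ∧ HasWeakDiv Ω G (Lap t)} →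
      IsW012 Ω (u t) G ∧ HasWeakDiv Ω G (Lap t) := fun t => by
    by_cases ht : t ∈ {t | ∃ G, IsW012 Ω (u t) G ∧ HasWeakDiv Ω G (Lap t)}
    · obtain ⟨G, hG⟩ := ht
      exact ⟨G, fun _ => hG⟩
    · exact ⟨fun _ => 0, fun h => absurd h ht⟩
  choose G hG using hex
  refine ⟨G, fun b τ => ∫ x in Ω, b (Hpos h (u τ x)) * v_t τ x, hVint,
    hweak.mono fun t ht => (hG t ht).1, ?_, ?_, ?_, ?_⟩
  · rintro b b' hb hb' ⟨B, hB⟩ ⟨B', hB'⟩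
    filter_upwards [hweak, ae_memLp_two_section hvt] with t h1 h3
    have hm : ∀ b : ℝ → ℝ, Continuous b → (∃ B, ∀ s, |b s| ≤ B) →
        Integrable (fun x => b (Hpos h (u t x)) * v_t t x) (volume.restrict Ω) := by
      rintro b hb ⟨B, hB⟩
      exact (h3.integrable (by norm_num)).bdd_mul
        ((hb.comp hah.continuous_Hpos).comp_aestronglyMeasurable (hG t h1).1.1.1)
        (Eventually.of_forall fun x => hB _)
    rw [← integral_sub (hm b' hb' ⟨B', hB'⟩) (hm b hb ⟨B, hB⟩)]
    simp only [sub_mul]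
  · exact fun b hb hB T hT => (hen b hb hB T hT).1
  · exact fun b hb hB s t hs hst => (hen b hb hB t (hs.trans hst)).2 s t hs hst le_rfl
  rintro b hb hbm hb0 ⟨B, hbB⟩ κ k hκ hκ0 hκw
  obtain ⟨hw, hwm, hw0⟩ := hah.weight hb hbm hb0
  filter_upwards [hweak, ae_restrict_mem measurableSet_Ioi, ae_memLp_two_section hvt,
    ae_memLp_two_section (g := fun t x => F a h (u t x) * Lap t x) hFL,
    Measure.ae_ae_of_ae_prod hineq] with t h1 h2 h3 h4 h5
  obtain ⟨hW, hD⟩ := hG t h1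
  have hnn := hu.nonneg t (le_of_lt h2)
  have hbm' : AEStronglyMeasurable (fun x => b (Hpos h (u t x))) (volume.restrict Ω) :=
    (hb.comp hah.continuous_Hpos).comp_aestronglyMeasurable hW.1.1
  have hbn : ∀ᵐ x ∂(volume.restrict Ω), ‖b (Hpos h (u t x))‖ ≤ B :=
    Eventually.of_forall fun x => hbB _
  have hI1 : Integrable (fun x => b (Hpos h (u t x)) * v_t t x) (volume.restrict Ω) :=
    (h3.integrable (by norm_num)).bdd_mul hbm' hbn
  have hI2 : Integrable (fun x => b (Hpos h (u t x)) * (F a h (u t x) * Lap t x))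
      (volume.restrict Ω) := (h4.integrable (by norm_num)).bdd_mul hbm' hbn
  have heq : (fun x => b (Hpos h (u t x)) * (F a h (u t x) * Lap t x)) =ᵐ[volume.restrict Ω]
      fun x => b (Hpos h (u t x)) * Fpos a h (u t x) * Lap t x := by
    filter_upwards [hnn] with x hx
    rw [Fpos_of_nonneg hx, mul_assoc]
  have hen' := hD.energy_le hΩb hW hnn hw hwm hw0 hκ hκ0 hκw (hI2.congr heq)
  rw [← integral_congr_ae heq] at hen'
  have hle : (∫ x in Ω, b (Hpos h (u t x)) * v_t t x) ≤
      ∫ x in Ω, b (Hpos h (u t x)) * (F a h (u t x) * Lap t x) := by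
    refine integral_mono_ae hI1 hI2 ?_
    filter_upwards [h5] with x hx
    exact mul_le_mul_of_nonneg_left (by linarith) (hb0 _)
  linarith

/-- The truncated weight `(p+1) min(r,K)^p`. -/
noncomputable def truncWeight (p K r : ℝ) : ℝ := (p + 1) * (min (max r 0) K) ^ p

variable {p K : ℝ}

lemma truncWeight_continuous (hp : 0 ≤ p) : Continuous (truncWeight p K) := by
  unfold truncWeight
  exact ((((continuous_id.max continuous_const).min continuous_const).rpow_const
    fun _ => Or.inr hp)).const_mul _

lemma truncWeight_nonneg (hp : 0 ≤ p) (hK : 0 ≤ K) (r : ℝ) : 0 ≤ truncWeight p K r :=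
  mul_nonneg (by linarith) (Real.rpow_nonneg (le_min (le_max_right _ _) hK) _)

lemma truncWeight_monotone (hp : 0 ≤ p) (hK : 0 ≤ K) : Monotone (truncWeight p K) := by
  intro r s hrs
  refine mul_le_mul_of_nonneg_left ?_ (by linarith)
  exact Real.rpow_le_rpow (le_min (le_max_right _ _) hK)
    (min_le_min_right _ (max_le_max_right _ hrs)) hp

lemma truncWeight_le (hp : 0 ≤ p) (hK : 0 ≤ K) (r : ℝ) : truncWeight p K r ≤ (p + 1) * K ^ p :=
  mul_le_mul_of_nonneg_left (Real.rpow_le_rpow (le_min (le_max_right _ _) hK)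
    (min_le_right _ _) hp) (by linarith)

lemma truncWeight_bounded (hp : 0 ≤ p) (hK : 0 ≤ K) : ∃ B, ∀ s, |truncWeight p K s| ≤ B :=
  ⟨_, fun s => (abs_of_nonneg (truncWeight_nonneg hp hK s)).trans_le (truncWeight_le hp hK s)⟩

lemma truncWeight_mono_right (hp : 0 ≤ p) (hK : 0 ≤ K) {K' : ℝ} (hKK : K ≤ K') (r : ℝ) :
    truncWeight p K r ≤ truncWeight p K' r :=
  mul_le_mul_of_nonneg_left (Real.rpow_le_rpow (le_min (le_max_right _ _) hK)
    (min_le_min_left _ hKK) hp) (by linarith)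

/-- The difference is 0 while the argument is at most `K`, and beyond that it is a monotone weight
minus a constant. It is thus itself an admissible weight, which makes the energy densities decrease
as the truncation level rises. -/
lemma truncWeight_sub_monotone (hp : 0 ≤ p) (hK : 0 ≤ K) {K' : ℝ} (hKK : K ≤ K') :
    Monotone fun r => truncWeight p K' r - truncWeight p K r := by
  intro r s hrs
  have h0 : max r 0 ≤ max s 0 := max_le_max_right _ hrs
  simp only
  rcases le_total (max s 0) K with h | h
  · have e1 : ∀ q, max q 0 ≤ K → truncWeight p K' q = truncWeight p K q := fun q hq => by
      unfold truncWeight; rw [min_eq_left hq, min_eq_left (hq.trans hKK)]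
    rw [e1 s h, e1 r (h0.trans h)]; simp
  · have e1 : truncWeight p K s = (p + 1) * K ^ p := by
      unfold truncWeight; rw [min_eq_right h]
    rcases le_total (max r 0) K with h' | h'
    · have e2 : truncWeight p K' r = truncWeight p K r := by
        unfold truncWeight; rw [min_eq_left h', min_eq_left (h'.trans hKK)]
      rw [e2, sub_self, sub_nonneg]
      exact truncWeight_mono_right hp hK hKK s
    · have e2 : truncWeight p K r = (p + 1) * K ^ p := by
        unfold truncWeight; rw [min_eq_right h']
      rw [e1, e2]
      linarith [truncWeight_monotone (p := p) hp (hK.trans hKK) hrs]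

lemma integral_rpow_primitive (hp : 0 ≤ p) {v : ℝ} :
    ∫ r in (0 : ℝ)..v, (p + 1) * r ^ p = v ^ (p + 1) := by
  rw [intervalIntegral.integral_const_mul, integral_rpow (Or.inl (by linarith)),
    Real.zero_rpow (by linarith), sub_zero]
  field_simp

lemma integral_truncWeight_of_le (hp : 0 ≤ p) {v : ℝ} (hv : 0 ≤ v) (hvK : v ≤ K) :
    ∫ r in (0 : ℝ)..v, truncWeight p K r = v ^ (p + 1) := by
  rw [← integral_rpow_primitive hp]
  refine intervalIntegral.integral_congr fun r hr => ?_
  rw [uIcc_of_le hv] at hr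
  simp only [truncWeight]
  rw [max_eq_left hr.1, min_eq_left (hr.2.trans hvK)]

lemma integral_truncWeight_le (hp : 0 ≤ p) (hK : 0 ≤ K) {v : ℝ} (hv : 0 ≤ v) :
    ∫ r in (0 : ℝ)..v, truncWeight p K r ≤ v ^ (p + 1) := by
  rw [← integral_truncWeight_of_le (K := max K v) hp hv (le_max_right _ _)]
  exact intervalIntegral.integral_mono_on hv
    ((truncWeight_continuous hp).intervalIntegrable _ _)
    ((truncWeight_continuous hp).intervalIntegrable _ _)
    fun r _ => truncWeight_mono_right hp hK (le_max_left _ _) r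

lemma integral_truncWeight_nonneg (hp : 0 ≤ p) (hK : 0 ≤ K) {v : ℝ} (hv : 0 ≤ v) :
    0 ≤ ∫ r in (0 : ℝ)..v, truncWeight p K r :=
  intervalIntegral.integral_nonneg hv fun r _ => truncWeight_nonneg hp hK r

end Energy

/-! ### Removing the truncation in time. -/

section MonotoneLimit

/-- Monotone convergence of nonpositive densities. -/
lemma exists_limit_density {t₀ : ℝ} {A : ℕ → ℝ → ℝ} {y : ℕ → ℝ → ℝ} {Y : ℝ → ℝ}
    (hA : ∀ n T, t₀ ≤ T → IntervalIntegrable (A n) volume t₀ T)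
    (hy : ∀ n s t, t₀ ≤ s → s ≤ t → y n t - y n s = ∫ τ in s..t, A n τ)
    (hA0 : ∀ n, ∀ᵐ t ∂(volume.restrict (Ioi t₀)), A n t ≤ 0)
    (hAn : ∀ n, ∀ᵐ t ∂(volume.restrict (Ioi t₀)), A (n + 1) t ≤ A n t)
    (hyY : ∀ t, t₀ ≤ t → Tendsto (fun n => y n t) atTop (𝓝 (Y t)))
    {M : ℝ} (hM : ∀ n t, t₀ ≤ t → y n t₀ - y n t ≤ M) :
    ∃ A' : ℝ → ℝ, (∀ T, t₀ ≤ T → IntervalIntegrable A' volume t₀ T) ∧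
      (∀ s t, t₀ ≤ s → s ≤ t → Y t - Y s = ∫ τ in s..t, A' τ) ∧
      ∀ᵐ t ∂(volume.restrict (Ioi t₀)), ∀ n, A' t ≤ A n t := by
  let f : ℕ → ℝ → ENNReal := fun n t => ENNReal.ofReal (-A n t)
  -- The supremum is taken in `ENNReal`, where it always exists. Monotone convergence and the bound
  -- `M` on the total drop show it is integrable; it then dominates every `-A n`.
  let S : ℝ → ENNReal := fun t => ⨆ n, f n t
  have hall : ∀ᵐ t ∂(volume.restrict (Ioi t₀)), ∀ n, A n t ≤ 0 ∧ A (n + 1) t ≤ A n t := by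
    rw [ae_all_iff]
    exact fun n => (hA0 n).and (hAn n)
  have hsub : ∀ T, Ioc t₀ T ⊆ Ioi t₀ := fun T => Ioc_subset_Ioi_self
  have hmeas : ∀ n T, t₀ ≤ T → AEMeasurable (f n) (volume.restrict (Ioc t₀ T)) := fun n T hT =>
    ((hA n T hT).1.1.aemeasurable.neg).ennreal_ofReal
  have hfm : ∀ᵐ t ∂(volume.restrict (Ioi t₀)), Monotone fun n => f n t := by
    filter_upwards [hall] with t ht
    exact monotone_nat_of_le_succ fun n => ENNReal.ofReal_le_ofReal (by linarith [(ht n).2])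
  have hSfin : ∀ T, t₀ ≤ T → ∫⁻ t in Ioc t₀ T, S t ≤ ENNReal.ofReal M := fun T hT => by
    rw [lintegral_iSup' (fun n => hmeas n T hT)
      (ae_restrict_of_ae_restrict_of_subset (hsub T) hfm)]
    refine iSup_le fun n => ?_
    have h0 := ofReal_integral_eq_lintegral_ofReal (f := fun t => -A n t) (hA n T hT).1.neg
      (ae_restrict_of_ae_restrict_of_subset (hsub T) (hall.mono fun t ht => by
        simpa using (ht n).1))
    refine h0.symm.le.trans (ENNReal.ofReal_le_ofReal ?_)
    have h1 := hy n t₀ T le_rfl hT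
    rw [intervalIntegral.integral_of_le hT] at h1
    have h2 := hM n T hT
    rw [integral_neg]
    linarith
  have hSm : ∀ T, t₀ ≤ T → AEMeasurable S (volume.restrict (Ioc t₀ T)) := fun T hT =>
    AEMeasurable.iSup fun n => hmeas n T hT
  have hSlt : ∀ T, t₀ ≤ T → ∀ᵐ t ∂(volume.restrict (Ioc t₀ T)), S t < ⊤ := fun T hT =>
    ae_lt_top' (hSm T hT) (ne_top_of_le_ne_top ENNReal.ofReal_ne_top (hSfin T hT))
  have hSlt' : ∀ᵐ t ∂(volume.restrict (Ioi t₀)), S t < ⊤ := by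
    have e : Ioi t₀ = ⋃ n : ℕ, Ioc t₀ (t₀ + n) := by
      ext t
      simp only [mem_Ioi, mem_iUnion, mem_Ioc]
      refine ⟨fun ht => ?_, fun ⟨_, h, _⟩ => h⟩
      obtain ⟨n, hn⟩ := exists_nat_ge (t - t₀)
      exact ⟨n, ht, by linarith⟩
    rw [e, ae_restrict_iUnion_iff]
    exact fun n => hSlt _ (by linarith [n.cast_nonneg (α := ℝ)])
  have hint : ∀ T, t₀ ≤ T → IntegrableOn (fun t => (S t).toReal) (Ioc t₀ T) := fun T hT =>
    integrable_toReal_of_lintegral_ne_top (hSm T hT)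
      (ne_top_of_le_ne_top ENNReal.ofReal_ne_top (hSfin T hT))
  have hle : ∀ᵐ t ∂(volume.restrict (Ioi t₀)), ∀ n, -A n t ≤ (S t).toReal := by
    filter_upwards [hSlt'] with t ht n
    exact (ENNReal.ofReal_le_iff_le_toReal ht.ne).1 (le_iSup (fun n => f n t) n)
  have hlim : ∀ᵐ t ∂(volume.restrict (Ioi t₀)),
      Tendsto (fun n => A n t) atTop (𝓝 (-(S t).toReal)) := by
    filter_upwards [hSlt', hfm, hall] with t h1 h2 h3
    have h4 := (ENNReal.tendsto_toReal h1.ne).comp (tendsto_atTop_iSup h2)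
    refine h4.neg.congr fun n => ?_
    simp only [Function.comp, f]
    rw [ENNReal.toReal_ofReal (by linarith [(h3 n).1]), neg_neg]
  have hII : ∀ T, t₀ ≤ T → IntervalIntegrable (fun t => -(S t).toReal) volume t₀ T :=
    fun T hT => (intervalIntegrable_iff_integrableOn_Ioc_of_le hT).2 (hint T hT).neg
  refine ⟨fun t => -(S t).toReal, hII, fun s t hs hst => ?_, hle.mono fun t ht n => by
    linarith [ht n]⟩
  have ht0 := hs.trans hst
  have hss : Ioc s t ⊆ Ioc t₀ t := Ioc_subset_Ioc_left hs
  have hT : Tendsto (fun n => ∫ τ in Ioc s t, A n τ) atTop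
      (𝓝 (∫ τ in Ioc s t, -(S τ).toReal)) := by
    refine tendsto_integral_of_dominated_convergence (fun τ => (S τ).toReal)
      (fun n => (hA n t ht0).1.1.mono_set hss) ((hint t ht0).mono_set hss) (fun n => ?_)
      (ae_restrict_of_ae_restrict_of_subset (hss.trans (hsub t)) hlim)
    refine ae_restrict_of_ae_restrict_of_subset (hss.trans (hsub t)) ?_
    filter_upwards [hle, hall] with τ h1 h2
    rw [Real.norm_of_nonpos (h2 n).1]
    exact h1 n
  rw [intervalIntegral.integral_of_le hst]
  refine tendsto_nhds_unique ((hyY t ht0).sub (hyY s hs)) (hT.congr fun n => ?_)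
  rw [hy n s t hs hst, intervalIntegral.integral_of_le hst]

end MonotoneLimit

/-! ### Propagation and dissipation of power integrals. -/

section PowerIntegrals

variable {N : ℕ} {Ω : Set (Space N)} {a h : ℝ → ℝ} {t₀ : ℝ}
  {u : ℝ → Space N → ℝ} {G : ℝ → Space N → Space N} {A : (ℝ → ℝ) → ℝ → ℝ} {p K : ℝ}

/-- The choice `κ = 0` in the energy inequality needs only that `b(H) F` is nondecreasing. -/
lemma EnergyDensity.nonpos (hE : EnergyDensity Ω a h t₀ u G A) (hah : Coefficients a h)
    {b : ℝ → ℝ} (hb : Continuous b) (hbm : Monotone b) (hb0 : ∀ s, 0 ≤ b s)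
    (hB : ∃ B, ∀ s, |b s| ≤ B) : ∀ᵐ t ∂(volume.restrict (Ioi t₀)), A b t ≤ 0 := by
  obtain ⟨-, hwm, -⟩ := hah.weight hb hbm hb0
  have h1 := hE.le b hb hbm hb0 hB (fun _ => 0) 0 continuous_const (fun _ => le_rfl)
    (fun r s hrs _ => by rw [zero_mul, sub_nonneg]; exact hwm hrs)
  filter_upwards [h1] with t ht
  simpa [indicator] using ht

/-- `∫ j(H(u(t)))` for the primitive `j` of the truncated weight. -/
noncomputable def truncEnergy (Ω : Set (Space N)) (h : ℝ → ℝ) (u : ℝ → Space N → ℝ)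
    (p K t : ℝ) : ℝ := ∫ x in Ω, ∫ r in (0 : ℝ)..Hpos h (u t x), truncWeight p K r

lemma EnergyDensity.integrable_trunc (hE : EnergyDensity Ω a h t₀ u G A) (hp : 0 ≤ p)
    (hK : 0 ≤ K) {t : ℝ} (ht : t₀ ≤ t) :
    Integrable (fun x => ∫ r in (0 : ℝ)..Hpos h (u t x), truncWeight p K r)
      (volume.restrict Ω) := by
  obtain ⟨B, hB⟩ := truncWeight_bounded (p := p) hp hK
  have hc : Continuous fun v => ∫ r in (0 : ℝ)..v, truncWeight p K r :=
    continuous_iff_continuousAt.2 fun v =>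
      ((truncWeight_continuous hp).integral_hasStrictDerivAt 0 v).hasDerivAt.continuousAt
  refine ((hE.integrable t ht).norm.const_mul B).mono'
    (hc.comp_aestronglyMeasurable (hE.integrable t ht).1) (Eventually.of_forall fun x => ?_)
  simpa using intervalIntegral.norm_integral_le_of_norm_le_const (a := 0) (b := Hpos h (u t x))
    (f := truncWeight p K) (C := B) (fun r _ => hB r)

lemma EnergyDensity.truncEnergy_le (hE : EnergyDensity Ω a h t₀ u G A) (hah : Coefficients a h)
    (hp : 0 ≤ p) (hK : 0 ≤ K) {s t : ℝ} (hs : t₀ ≤ s) (hst : s ≤ t) :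
    truncEnergy Ω h u p K t ≤ truncEnergy Ω h u p K s := by
  have h1 := hE.identity _ (truncWeight_continuous (K := K) hp) (truncWeight_bounded hp hK) s t
    hs hst
  have h2 := hE.nonpos hah (truncWeight_continuous (K := K) hp) (truncWeight_monotone hp hK)
    (truncWeight_nonneg hp hK) (truncWeight_bounded hp hK)
  have h3 : ∫ τ in s..t, A (truncWeight p K) τ ≤ 0 := by
    rw [intervalIntegral.integral_of_le hst]
    exact integral_nonpos_of_ae (ae_restrict_of_ae_restrict_of_subset
      (Ioc_subset_Ioi_self.trans (Ioi_subset_Ioi hs)) h2)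
  unfold truncEnergy
  linarith

/-- Propagation of the integrability of `H(u)^{p+1}`. -/
lemma EnergyDensity.power_integrable (hE : EnergyDensity Ω a h t₀ u G A) (hah : Coefficients a h)
    (hp : 0 ≤ p) (h0 : Integrable (fun x => Hpos h (u t₀ x) ^ (p + 1)) (volume.restrict Ω))
    {t : ℝ} (ht : t₀ ≤ t) :
    Integrable (fun x => Hpos h (u t x) ^ (p + 1)) (volume.restrict Ω) ∧
      ∫ x in Ω, Hpos h (u t x) ^ (p + 1) ≤ ∫ x in Ω, Hpos h (u t₀ x) ^ (p + 1) := by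
  have hnn := hah.Hpos_nonneg
  have hm : AEStronglyMeasurable (fun x => Hpos h (u t x) ^ (p + 1)) (volume.restrict Ω) :=
    (Real.continuous_rpow_const (by linarith)).comp_aestronglyMeasurable (hE.integrable t ht).1
  have hj0 : ∀ (n : ℕ) t x, 0 ≤ ∫ r in (0 : ℝ)..Hpos h (u t x), truncWeight p n r := fun n t x =>
    integral_truncWeight_nonneg hp n.cast_nonneg (hnn _)
  have hbd : ∀ n : ℕ, truncEnergy Ω h u p n t ≤ ∫ x in Ω, Hpos h (u t₀ x) ^ (p + 1) := fun n =>
    (hE.truncEnergy_le hah hp n.cast_nonneg le_rfl ht).trans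
      (integral_mono (hE.integrable_trunc hp n.cast_nonneg le_rfl) h0
        fun x => integral_truncWeight_le hp n.cast_nonneg (hnn _))
  have hlim : ∀ x, Tendsto (fun n : ℕ => ENNReal.ofReal
      (∫ r in (0 : ℝ)..Hpos h (u t x), truncWeight p n r)) atTop
      (𝓝 (ENNReal.ofReal (Hpos h (u t x) ^ (p + 1)))) := fun x => by
    obtain ⟨m, hm⟩ := exists_nat_ge (Hpos h (u t x))
    refine tendsto_const_nhds.congr' ?_
    filter_upwards [eventually_ge_atTop m] with n hn
    rw [integral_truncWeight_of_le hp (hnn _) (hm.trans (by exact_mod_cast hn))]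
  -- Fatou along the truncation levels: each truncated energy is at most its initial value, hence at
  -- most the full initial integral.
  have hL : ∫⁻ x in Ω, ENNReal.ofReal (Hpos h (u t x) ^ (p + 1)) ≤
      ENNReal.ofReal (∫ x in Ω, Hpos h (u t₀ x) ^ (p + 1)) := by
    calc ∫⁻ x in Ω, ENNReal.ofReal (Hpos h (u t x) ^ (p + 1))
        = ∫⁻ x in Ω, liminf (fun n : ℕ => ENNReal.ofReal
            (∫ r in (0 : ℝ)..Hpos h (u t x), truncWeight p n r)) atTop :=
          lintegral_congr fun x => (hlim x).liminf_eq.symm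
      _ ≤ liminf (fun n : ℕ => ∫⁻ x in Ω, ENNReal.ofReal
            (∫ r in (0 : ℝ)..Hpos h (u t x), truncWeight p n r)) atTop :=
          lintegral_liminf_le' fun n =>
            (hE.integrable_trunc hp n.cast_nonneg ht).1.aemeasurable.ennreal_ofReal
      _ ≤ _ := by
          refine liminf_le_of_frequently_le' (Frequently.of_forall fun n => ?_)
          rw [← ofReal_integral_eq_lintegral_ofReal (hE.integrable_trunc hp n.cast_nonneg ht)
            (Eventually.of_forall (hj0 n t))]
          exact ENNReal.ofReal_le_ofReal (hbd n)
  have hpos : ∀ t x, 0 ≤ Hpos h (u t x) ^ (p + 1) := fun t x => Real.rpow_nonneg (hnn _) _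
  have hint : Integrable (fun x => Hpos h (u t x) ^ (p + 1)) (volume.restrict Ω) := by
    refine ⟨hm, ?_⟩
    rw [hasFiniteIntegral_iff_ofReal (Eventually.of_forall (hpos t))]
    exact hL.trans_lt ENNReal.ofReal_lt_top
  refine ⟨hint, ?_⟩
  rw [← ofReal_integral_eq_lintegral_ofReal hint (Eventually.of_forall (hpos t))] at hL
  exact (ENNReal.ofReal_le_ofReal_iff (integral_nonneg (hpos t₀))).1 hL

lemma EnergyDensity.tendsto_truncEnergy (hE : EnergyDensity Ω a h t₀ u G A)
    (hah : Coefficients a h) (hp : 0 ≤ p) {t : ℝ} (ht : t₀ ≤ t)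
    (hint : Integrable (fun x => Hpos h (u t x) ^ (p + 1)) (volume.restrict Ω))
    {K : ℕ → ℝ} (hK : ∀ n, 0 ≤ K n) (hKt : Tendsto K atTop atTop) :
    Tendsto (fun n => truncEnergy Ω h u p (K n) t) atTop
      (𝓝 (∫ x in Ω, Hpos h (u t x) ^ (p + 1))) := by
  have hnn := hah.Hpos_nonneg
  refine tendsto_integral_of_dominated_convergence _
    (fun n => (hE.integrable_trunc hp (hK n) ht).1) hint
    (fun n => Eventually.of_forall fun x => ?_) (Eventually.of_forall fun x => ?_)
  · rw [Real.norm_of_nonneg (integral_truncWeight_nonneg hp (hK n) (hnn _))]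
    exact integral_truncWeight_le hp (hK n) (hnn _)
  · refine tendsto_const_nhds.congr' ?_
    filter_upwards [hKt.eventually_ge_atTop (Hpos h (u t x))] with n hn
    rw [integral_truncWeight_of_le hp (hnn _) hn]

/-- The power integral has an integrable density bounded by a superlinear power of itself. -/
lemma EnergyDensity.exists_decay_density (hE : EnergyDensity Ω a h t₀ u G A)
    (hah : Coefficients a h) (hN : 1 ≤ N) (hΩb : Bornology.IsBounded Ω)
    {p₁ q₁ c₃ γ₁ β c₄ δ₁ δ₂ p₀ : ℝ} (hp₁ : 0 < p₁) (hq₁ : 0 < q₁) (hc₃ : 0 < c₃)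
    (hlow : LowerStructure a h p₁ q₁ c₃) (hγ₁ : 0 < γ₁) (hβ : 0 < β) (hc₄ : 0 < c₄)
    (hup : UpperStructure h γ₁ β c₄) (hβq : q₁ / 2 < β) (hδ₁ : δ₁ = delta1 p₁ γ₁)
    (hδ₁_one : 1 ≤ δ₁) (hδ₁_two : δ₁ < 2) (hδ₂ : δ₂ = delta2 N δ₁) (hp₀ : p₀ = expP0 β q₁ δ₂)
    (h0 : Integrable (fun x => Hpos h (u t₀ x) ^ (p₁ + 1)) (volume.restrict Ω))
    (hZi : ∀ t, t₀ ≤ t → IntegrableOn (fun x => Hpos h (u t x) ^ p₀) Ω) {Zb : ℝ}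
    (hZb : ∀ t, t₀ ≤ t → ∫ x in Ω, Hpos h (u t x) ^ p₀ ≤ Zb) :
    ∃ (C : ℝ) (A' : ℝ → ℝ), 0 < C ∧ (∀ T, t₀ ≤ T → IntervalIntegrable A' volume t₀ T) ∧
      (∀ s t, t₀ ≤ s → s ≤ t → (∫ x in Ω, Hpos h (u t x) ^ (p₁ + 1)) -
        (∫ x in Ω, Hpos h (u s x) ^ (p₁ + 1)) = ∫ τ in s..t, A' τ) ∧
      ∀ᵐ t ∂(volume.restrict (Ioi t₀)),
        A' t ≤ -(C * (∫ x in Ω, Hpos h (u t x) ^ (p₁ + 1)) ^ (2 / δ₁)) := by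
  obtain ⟨D, hD, hgrad⟩ := IsW012.gradient_bound (Ω := Ω) hah hN hΩb hp₁ hγ₁ hβ hc₄ hq₁ hup hβq hδ₁
    hδ₁_one hδ₁_two hδ₂ hp₀
  have hd := delta2_pos hN hδ₁_one hδ₁_two
  rw [← hδ₂] at hd
  have hnn := hah.Hpos_nonneg
  have hp : 0 ≤ p₁ := hp₁.le
  have hpow := fun t (ht : t₀ ≤ t) => hE.power_integrable hah hp h0 ht
  -- The term `H(n+1)` makes the truncation inactive where `u ≤ n + 1`; the term `n` sends `K` to
  -- infinity even when `H` is bounded.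
  let K : ℕ → ℝ := fun n => Hpos h (n + 1) + n
  have hKn : ∀ n : ℕ, (n : ℝ) ≤ K n := fun n => by simp only [K]; linarith [hnn (n + 1)]
  have hK0 : ∀ n, 0 ≤ K n := fun n => n.cast_nonneg.trans (hKn n)
  have hKt : Tendsto K atTop atTop := tendsto_atTop_mono hKn tendsto_natCast_atTop_atTop
  have hKs : ∀ n, K n ≤ K (n + 1) := fun n => by
    simp only [K]
    push_cast
    linarith [hah.monotone_Hpos (show (n : ℝ) + 1 ≤ n + 1 + 1 by linarith)]
  have hbc : ∀ n, Continuous (truncWeight p₁ (K n)) := fun n => truncWeight_continuous hp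
  have hbB : ∀ n, ∃ B, ∀ s, |truncWeight p₁ (K n) s| ≤ B := fun n => truncWeight_bounded hp (hK0 n)
  have hA0 : ∀ n, ∀ᵐ t ∂(volume.restrict (Ioi t₀)), A (truncWeight p₁ (K n)) t ≤ 0 := fun n =>
    hE.nonpos hah (hbc n) (truncWeight_monotone hp (hK0 n)) (truncWeight_nonneg hp (hK0 n)) (hbB n)
  have hAn : ∀ n, ∀ᵐ t ∂(volume.restrict (Ioi t₀)),
      A (truncWeight p₁ (K (n + 1))) t ≤ A (truncWeight p₁ (K n)) t := fun n => by
    obtain ⟨B, hB⟩ := hbB n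
    obtain ⟨B', hB'⟩ := hbB (n + 1)
    filter_upwards [hE.sub _ _ (hbc n) (hbc (n + 1)) (hbB n) (hbB (n + 1)),
      hE.nonpos hah ((hbc (n + 1)).sub (hbc n)) (truncWeight_sub_monotone hp (hK0 n) (hKs n))
        (fun s => sub_nonneg.2 (truncWeight_mono_right hp (hK0 n) (hKs n) s))
        ⟨B' + B, fun s => (abs_sub _ _).trans (add_le_add (hB' s) (hB s))⟩] with t h1 h2
    have h3 := h1.symm.trans_le h2
    linarith
  have hyn : ∀ n t, 0 ≤ truncEnergy Ω h u p₁ (K n) t := fun n t =>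
    integral_nonneg fun x => integral_truncWeight_nonneg hp (hK0 n) (hnn _)
  obtain ⟨A', hA'i, hA', hA'le⟩ := exists_limit_density
    (A := fun n => A (truncWeight p₁ (K n))) (y := fun n => truncEnergy Ω h u p₁ (K n))
    (Y := fun t => ∫ x in Ω, Hpos h (u t x) ^ (p₁ + 1)) (t₀ := t₀)
    (M := ∫ x in Ω, Hpos h (u t₀ x) ^ (p₁ + 1))
    (fun n T hT => hE.intervalIntegrable _ (hbc n) (hbB n) T hT)
    (fun n s t hs hst => hE.identity _ (hbc n) (hbB n) s t hs hst) hA0 hAn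
    (fun t ht => hE.tendsto_truncEnergy hah hp ht (hpow t ht).1 hK0 hKt)
    (fun n t ht => by
      have := integral_mono (hE.integrable_trunc hp (hK0 n) le_rfl) h0
        fun x => integral_truncWeight_le hp (hK0 n) (hnn (u t₀ x))
      have h2 := hyn n t
      unfold truncEnergy at *
      linarith)
  -- The maximum with 1 keeps `Q`, by which one divides, positive even if `Zb = 0`.
  set Q : ℝ := D * max Zb 1 ^ ((2 - δ₂) / δ₂) with hQ
  have hQ0 : 0 < Q := by positivity
  have hκc : Continuous fun s => (p₁ + 1) * (c₃ * Hpos h s ^ q₁) :=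
    ((hah.continuous_Hpos.rpow_const fun _ => Or.inr hq₁.le).const_mul _).const_mul _
  have hκ : ∀ n : ℕ, ∀ᵐ t ∂(volume.restrict (Ioi t₀)), A (truncWeight p₁ (K n)) t ≤
      -∫ x in Ω, (Iic ((n : ℝ) + 1)).indicator (fun s => (p₁ + 1) * (c₃ * Hpos h s ^ q₁)) (u t x) *
        ‖G t x‖ ^ 2 := fun n => by
    refine hE.le _ (hbc n) (truncWeight_monotone hp (hK0 n)) (truncWeight_nonneg hp (hK0 n)) (hbB n)
      _ _ hκc (fun s => by have := Real.rpow_nonneg (hnn s) q₁; positivity) fun r s hrs hs => ?_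
    have e : ∀ s : ℝ, s ≤ n + 1 →
        truncWeight p₁ (K n) (Hpos h s) = (p₁ + 1) * Hpos h s ^ p₁ := fun s hs => by
      unfold truncWeight
      rw [max_eq_left (hnn s), min_eq_left]
      exact (hah.monotone_Hpos hs).trans (by simp [K])
    rw [e s hs, e r (hrs.trans hs)]
    have := mul_le_mul_of_nonneg_left (hlow.mul_sub_le hah hp₁ hq₁ hc₃ hrs)
      (show 0 ≤ p₁ + 1 by linarith)
    linarith
  refine ⟨(p₁ + 1) * c₃ / Q, A', by positivity, hA'i, hA', ?_⟩
  filter_upwards [ae_all_iff.2 hκ, hA'le, hE.isW012, ae_restrict_mem measurableSet_Ioi]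
    with t h1 h2 h3 h4
  have ht : t₀ ≤ t := le_of_lt h4
  have hXlim : Tendsto (fun n : ℕ => ∫ x in Ω, Hpos h (min (u t x) n) ^ (p₁ + 1)) atTop
      (𝓝 (∫ x in Ω, Hpos h (u t x) ^ (p₁ + 1))) := by
    refine tendsto_integral_of_dominated_convergence (fun x => Hpos h (u t x) ^ (p₁ + 1))
      (fun n => ?_) (hpow t ht).1
      (fun n => Eventually.of_forall fun x => ?_) (Eventually.of_forall fun x => ?_)
    · have hc : Continuous fun s => Hpos h (min s n) ^ (p₁ + 1) :=
        (hah.continuous_Hpos.comp (continuous_id.min continuous_const)).rpow_const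
          fun _ => Or.inr (by linarith)
      exact hc.comp_aestronglyMeasurable h3.1.1
    · rw [Real.norm_of_nonneg (Real.rpow_nonneg (hnn _) _)]
      exact Real.rpow_le_rpow (hnn _) (hah.monotone_Hpos (min_le_left _ _)) (by linarith)
    · obtain ⟨m, hm⟩ := exists_nat_ge (u t x)
      refine tendsto_const_nhds.congr' ?_
      filter_upwards [eventually_ge_atTop m] with n hn
      rw [min_eq_left (hm.trans (by exact_mod_cast hn))]
  have hlim := ((hXlim.rpow_const (p := 2 / δ₁) (Or.inr (by positivity))).const_mul
    ((p₁ + 1) * c₃ / Q)).neg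
  -- The limiting density lies below every `A n`, so only the gradient bound for `min u n` has to be
  -- passed to the limit.
  refine ge_of_tendsto' hlim fun n => (h2 n).trans ((h1 n).trans (neg_le_neg ?_))
  have e1 : (∫ x in Ω, (Iic ((n : ℝ) + 1)).indicator (fun s => (p₁ + 1) * (c₃ * Hpos h s ^ q₁))
      (u t x) * ‖G t x‖ ^ 2) = (p₁ + 1) * c₃ * ∫ x in Ω, (Iic ((n : ℝ) + 1)).indicator
      (fun s => Hpos h s ^ q₁) (u t x) * ‖G t x‖ ^ 2 := by
    rw [← integral_const_mul]
    congr 1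
    funext x
    by_cases hx : u t x ∈ Iic ((n : ℝ) + 1)
    · rw [indicator_of_mem hx, indicator_of_mem hx]; ring
    · rw [indicator_of_notMem hx, indicator_of_notMem hx]; ring
  rw [e1, div_mul_eq_mul_div, div_le_iff₀ hQ0, mul_assoc _ _ Q]
  refine mul_le_mul_of_nonneg_left ((hgrad _ _ h3 (hZi t ht) n).trans ?_) (by positivity)
  rw [mul_comm _ Q]
  refine mul_le_mul_of_nonneg_right ?_ (integral_nonneg fun x =>
    mul_nonneg (indicator_nonneg (fun s _ => Real.rpow_nonneg (hnn _) _) _) (sq_nonneg _))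
  refine mul_le_mul_of_nonneg_left (Real.rpow_le_rpow
    (integral_nonneg fun x => Real.rpow_nonneg (hnn _) _)
    ((hZb t ht).trans (le_max_left _ _)) ?_) hD.le
  exact div_nonneg (by linarith) (by linarith)

end PowerIntegrals

/-! ### Decay from the integrated differential inequality. -/

section ScalarInequality

/-- The tangent line inequality for `x ↦ x ^ (-σ)`. -/
lemma one_sub_mul_le_rpow_neg {x σ : ℝ} (hx : 0 < x) (hσ : 0 ≤ σ) :
    1 - σ * (x - 1) ≤ x ^ (-σ) := by
  rw [Real.rpow_def_of_pos hx]
  have h1 := Real.add_one_le_exp (Real.log x * -σ)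
  have h2 := mul_le_mul_of_nonneg_left (Real.log_le_sub_one_of_pos hx) hσ
  linarith

/-- Decay of a nonincreasing function with `Y' ≤ -C Y^{σ+1}` in integrated form. -/
lemma rpow_neg_ge_of_decay {Y : ℝ → ℝ} {t₀ t C σ : ℝ} (hσ : 0 < σ) (ht : t₀ ≤ t)
    (hYc : ContinuousOn Y (Icc t₀ t)) (hpos : ∀ s ∈ Icc t₀ t, 0 < Y s)
    (hdec : ∀ s r, t₀ ≤ s → s ≤ r → r ≤ t → Y r - Y s ≤ -(C * Y r ^ (σ + 1) * (r - s))) :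
    Y t₀ ^ (-σ) + σ * C * (t - t₀) ≤ Y t ^ (-σ) := by
  have hYσ : ∀ p : ℝ, ContinuousOn (fun s => Y s ^ p) (Icc t₀ t) := fun p =>
    hYc.rpow_const fun s hs => Or.inl (hpos s hs).ne'
  -- Comparing right slopes of `-Y^{-σ}` with the slope `-σC` of a line needs only continuity of
  -- `Y`, no chain rule at points of differentiability.
  have key := image_le_of_liminf_slope_right_le_deriv_boundary (a := t₀) (b := t)
    (f := fun s => -Y s ^ (-σ)) (B := fun s => -(Y t₀ ^ (-σ) + σ * C * (s - t₀)))
    (B' := fun _ => -(σ * C)) (hYσ _).neg (by simp) (by fun_prop) ?_ ?_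
    (right_mem_Icc.2 ht)
  · simpa using key
  · intro x _
    have h1 := (((hasDerivAt_id x).sub_const t₀).const_mul (σ * C)).const_add (Y t₀ ^ (-σ))
    exact (h1.neg.congr_deriv (by ring)).hasDerivWithinAt
  · intro x hx r hr
    refine Eventually.frequently ?_
    have hxI : x ∈ Icc t₀ t := Ico_subset_Icc_self hx
    have hq := hpos x hxI
    have hle : 𝓝[>] x ≤ 𝓝[Icc t₀ t] x :=
      nhdsWithin_le_of_mem (mem_of_superset (Ioc_mem_nhdsGT hx.2)
        fun z hz => ⟨hx.1.trans hz.1.le, hz.2⟩)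
    have hlim : Tendsto (fun z => -(σ * C * (Y z ^ (σ + 1) * Y x ^ (-(σ + 1))))) (𝓝[>] x)
        (𝓝 (-(σ * C))) := by
      have h1 : Tendsto (fun z => Y z ^ (σ + 1)) (𝓝[>] x) (𝓝 (Y x ^ (σ + 1))) :=
        ((hYσ (σ + 1)) x hxI).mono_left hle
      have h2 := ((h1.mul_const (Y x ^ (-(σ + 1)))).const_mul (σ * C)).neg
      rwa [← Real.rpow_add hq, add_neg_cancel, Real.rpow_zero, mul_one] at h2
    filter_upwards [hlim.eventually (gt_mem_nhds hr), Ioc_mem_nhdsGT hx.2] with z hz hzI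
    refine lt_of_le_of_lt ?_ hz
    have hzx : 0 < z - x := sub_pos.2 hzI.1
    have hy := hpos z ⟨hx.1.trans hzI.1.le, hzI.2⟩
    rw [slope_def_field, div_le_iff₀ hzx]
    -- Convexity of `y ↦ y^{-σ}`: the tangent line at `Y x` turns the decrease of `Y` into an
    -- increase of `Y^{-σ}`.
    have h1 := one_sub_mul_le_rpow_neg (div_pos hy hq) hσ.le
    rw [Real.div_rpow hy.le hq.le, le_div_iff₀ (Real.rpow_pos_of_pos hq _)] at h1
    have h2 := hdec x z hx.1 hzI.1.le hzI.2
    have h3 : Y x ^ (-(σ + 1)) * Y x = Y x ^ (-σ) := by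
      rw [← Real.rpow_add_one hq.ne']; congr 1; ring
    have h4 : (1 - σ * (Y z / Y x - 1)) * Y x ^ (-σ) =
        Y x ^ (-σ) - σ * Y x ^ (-(σ + 1)) * (Y z - Y x) := by
      rw [← h3]; field_simp
    rw [h4] at h1
    have h5 := mul_le_mul_of_nonneg_left h2
      (show 0 ≤ σ * Y x ^ (-(σ + 1)) from mul_nonneg hσ.le (Real.rpow_nonneg hq.le _))
    linarith

end ScalarInequality

lemma _root_.AbsolutelyContinuousOnInterval.congr {X : Type*} [PseudoMetricSpace X] {f g : ℝ → X}
    {a b : ℝ} (hf : AbsolutelyContinuousOnInterval f a b) (hfg : EqOn f g (uIcc a b)) :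
    AbsolutelyContinuousOnInterval g a b := by
  refine Tendsto.congr' ?_ hf
  filter_upwards [mem_inf_of_right (mem_principal_self _)] with E hE
  refine Finset.sum_congr rfl fun i hi => ?_
  have := hE.1 i hi
  rw [hfg this.1, hfg this.2]

lemma ae_restrict_Ioi_of_forall_Icc {P : ℝ → Prop} {t₀ : ℝ}
    (h : ∀ T, t₀ < T → ∀ᵐ t, t ∈ uIcc t₀ T → P t) : ∀ᵐ t ∂(volume.restrict (Ioi t₀)), P t := by
  rw [ae_restrict_iff' measurableSet_Ioi]
  have h1 : ∀ᵐ t, ∀ n : ℕ, t ∈ uIcc t₀ (t₀ + (n + 1)) → P t :=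
    ae_all_iff.2 fun n => h _ (by linarith [n.cast_nonneg (α := ℝ)])
  filter_upwards [h1] with t ht htt
  obtain ⟨n, hn⟩ := exists_nat_ge (t - t₀)
  refine ht n ?_
  rw [uIcc_of_le (by linarith [n.cast_nonneg (α := ℝ)])]
  exact ⟨le_of_lt htt, by linarith⟩

end Einstein

/-! ### Assembly of the corollary. -/

theorem mainTheorem5 (N : ℕ) (hN : 1 ≤ N) (Ω : Set (Einstein.Space N)) (hΩ : IsOpen Ω)
    (hΩb : Bornology.IsBounded Ω) (a h : ℝ → ℝ) (hah : Einstein.Coefficients a h)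
    (t₀ : ℝ) (u₀ : Einstein.Space N → ℝ) (u : ℝ → Einstein.Space N → ℝ)
    (hu : Einstein.IsSolution Ω a h t₀ u₀ u)
    (p₁ q₁ c₃ : ℝ) (hp₁ : 0 < p₁) (hq₁ : 0 < q₁) (hc₃ : 0 < c₃)
    (hlow : Einstein.LowerStructure a h p₁ q₁ c₃)
    (γ₁ β c₄ : ℝ) (hγ₁ : 0 < γ₁) (hβ : 0 < β) (hc₄ : 0 < c₄)
    (hup : Einstein.UpperStructure h γ₁ β c₄)
    (hβq : q₁ / 2 < β)
    (δ₁ δ₂ p₀ : ℝ) (hδ₁ : δ₁ = Einstein.delta1 p₁ γ₁)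
    (hδ₁_one : 1 ≤ δ₁) (hδ₁_two : δ₁ < 2)
    (hδ₂ : δ₂ = Einstein.delta2 N δ₁) (hp₀ : p₀ = Einstein.expP0 β q₁ δ₂)
    (hw₁ : Einstein.PowerInW012 Ω a h t₀ u p₁)
    (hu₀₁ : MemLp (fun x => Einstein.H h (u₀ x)) (ENNReal.ofReal (p₁ + 1)) (volume.restrict Ω))
    (pstar : ℝ) (hpstar : 0 ≤ pstar) (hpstar₀ : p₀ ≤ pstar + 1)
    (hmono : Einstein.WeightMonotone a h pstar)
    (hwstar : Einstein.PowerInW012 Ω a h t₀ u pstar)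
    (hu₀star : MemLp (fun x => Einstein.H h (u₀ x)) (ENNReal.ofReal (pstar + 1))
      (volume.restrict Ω))
    (Y Z : ℝ → ℝ) (hY : ∀ t, Y t = Einstein.powerIntegral Ω h u (p₁ + 1) t)
    (hZ : ∀ t, Z t = Einstein.powerIntegral Ω h u p₀ t) :
    -- `Y(t)` and `Z(t)` are finite and `Z` is uniformly bounded
    (∀ t, t₀ ≤ t → IntegrableOn (fun x => Einstein.H h (u t x) ^ (p₁ + 1)) Ω volume) ∧
    (∀ t, t₀ ≤ t → IntegrableOn (fun x => Einstein.H h (u t x) ^ p₀) Ω volume) ∧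
    (∃ K : ℝ, ∀ t, t₀ ≤ t → Z t ≤ K) ∧
    -- `Y` is locally absolutely continuous, hence differentiable almost everywhere
    (∀ T, t₀ < T → AbsolutelyContinuousOnInterval Y t₀ T) ∧
    (∀ᵐ t ∂(volume.restrict (Ioi t₀)), DifferentiableAt ℝ Y t) ∧
    -- the differential inequality and the decay
    (∃ C₂ : ℝ, 0 < C₂ ∧
      (∀ t, t₀ < t → DifferentiableAt ℝ Y t → deriv Y t + C₂ * Y t ^ (2 / δ₁) ≤ 0) ∧
      (0 < Y t₀ → ∀ t, t₀ ≤ t →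
        Y t ≤ (C₂ * ((2 - δ₁) / δ₁) * (t - t₀) + Y t₀ ^ (-((2 - δ₁) / δ₁))) ^
          (-(δ₁ / (2 - δ₁))))) ∧
    (Y t₀ = 0 → ∀ t, t₀ ≤ t → Y t = 0) ∧
    Tendsto Y atTop (𝓝 0) := by
  have hnn := hah.Hpos_nonneg
  have hfin : IsFiniteMeasure (volume.restrict Ω) :=
    ⟨by simpa using hΩb.measure_lt_top⟩
  have hHu : ∀ t, t₀ ≤ t → ∀ p : ℝ, (fun x => Einstein.Hpos h (u t x) ^ p) =ᵐ[volume.restrict Ω]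
      fun x => Einstein.H h (u t x) ^ p := fun t ht p => by
    filter_upwards [hu.nonneg t ht] with x hx
    simp only [Einstein.Hpos_of_nonneg hx]
  have hYt : ∀ t, t₀ ≤ t → Y t = ∫ x in Ω, Einstein.Hpos h (u t x) ^ (p₁ + 1) := fun t ht =>
    (hY t).trans (integral_congr_ae (hHu t ht _).symm)
  have hZt : ∀ t, t₀ ≤ t → Z t = ∫ x in Ω, Einstein.Hpos h (u t x) ^ p₀ := fun t ht =>
    (hZ t).trans (integral_congr_ae (hHu t ht _).symm)
  have hinit : ∀ p, 0 ≤ p → MemLp (fun x => Einstein.H h (u₀ x)) (ENNReal.ofReal (p + 1))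
      (volume.restrict Ω) → Integrable (fun x => Einstein.Hpos h (u t₀ x) ^ (p + 1))
      (volume.restrict Ω) := fun p hp hL => by
    have h1 := hL.integrable_norm_rpow (by simp; linarith) (by simp)
    rw [ENNReal.toReal_ofReal (by linarith)] at h1
    refine h1.congr ?_
    filter_upwards [hu.nonneg t₀ le_rfl, hu.initial] with x h2 h3
    rw [← h3, Einstein.Hpos_of_nonneg h2, Real.norm_of_nonneg (hah.H_nonneg h2)]
  obtain ⟨G, A, hE⟩ := hu.exists_energyDensity hΩb hah
    (hu₀₁.integrable (by simp; linarith))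
  have h0 := hinit p₁ hp₁.le hu₀₁
  have h0s := hinit pstar hpstar hu₀star
  have hYi := fun t (ht : t₀ ≤ t) => hE.power_integrable hah hp₁.le h0 ht
  have hSi := fun t (ht : t₀ ≤ t) => hE.power_integrable hah hpstar h0s ht
  obtain ⟨hd1, hd2⟩ := Einstein.delta2_pos hN hδ₁_one hδ₁_two
  rw [← hδ₂] at hd1 hd2
  have hp₀0 : 0 < p₀ := by
    rw [hp₀, Einstein.expP0]
    exact mul_pos (by linarith) (div_pos (by linarith) (by linarith))
  have hpt : ∀ t x, Einstein.Hpos h (u t x) ^ p₀ ≤ 1 + Einstein.Hpos h (u t x) ^ (pstar + 1) :=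
    fun t x => by
    rcases le_total (Einstein.Hpos h (u t x)) 1 with h1 | h1
    · have := Real.rpow_le_one (hnn _) h1 hp₀0.le
      linarith [Real.rpow_nonneg (hnn (u t x)) (pstar + 1)]
    · linarith [Real.rpow_le_rpow_of_exponent_le h1 hpstar₀]
  have hdom : ∀ t, t₀ ≤ t → Integrable (fun x => 1 + Einstein.Hpos h (u t x) ^ (pstar + 1))
      (volume.restrict Ω) := fun t ht => (integrable_const 1).add (hSi t ht).1
  have hZi : ∀ t, t₀ ≤ t → IntegrableOn (fun x => Einstein.Hpos h (u t x) ^ p₀) Ω := fun t ht =>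
    (hdom t ht).mono' ((Real.continuous_rpow_const hp₀0.le).comp_aestronglyMeasurable
      (hE.integrable t ht).1) (Eventually.of_forall fun x => by
        rw [Real.norm_of_nonneg (Real.rpow_nonneg (hnn _) _)]; exact hpt t x)
  have hZb : ∀ t, t₀ ≤ t → ∫ x in Ω, Einstein.Hpos h (u t x) ^ p₀ ≤
      (volume.restrict Ω).real univ + ∫ x in Ω, Einstein.Hpos h (u t₀ x) ^ (pstar + 1) :=
    fun t ht => by
    refine (integral_mono (hZi t ht) (hdom t ht) (hpt t)).trans ?_
    rw [integral_add (integrable_const 1) (hSi t ht).1]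
    simpa using (hSi t ht).2
  obtain ⟨C, A', hC, hA'i, hA', hA'le⟩ := hE.exists_decay_density hah hN hΩb hp₁ hq₁ hc₃ hlow hγ₁
    hβ hc₄ hup hβq hδ₁ hδ₁_one hδ₁_two hδ₂ hp₀ h0 hZi hZb
  have hY0 : ∀ t, t₀ ≤ t → 0 ≤ Y t := fun t ht => by
    rw [hYt t ht]; exact integral_nonneg fun x => Real.rpow_nonneg (hnn _) _
  have hYsub : ∀ s t, t₀ ≤ s → s ≤ t → Y t - Y s = ∫ τ in s..t, A' τ := fun s t hs hst => by
    rw [hYt t (hs.trans hst), hYt s hs, hA' s t hs hst]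
  have hA'le' : ∀ᵐ t ∂(volume.restrict (Ioi t₀)), A' t ≤ -(C * Y t ^ (2 / δ₁)) := by
    filter_upwards [hA'le, ae_restrict_mem measurableSet_Ioi] with t h1 h2
    rwa [hYt t (le_of_lt h2)]
  have hanti : ∀ s t, t₀ ≤ s → s ≤ t → Y t ≤ Y s := fun s t hs hst => by
    have h1 : ∫ τ in s..t, A' τ ≤ 0 := by
      rw [intervalIntegral.integral_of_le hst]
      refine integral_nonpos_of_ae (ae_restrict_of_ae_restrict_of_subset
        (Ioc_subset_Ioi_self.trans (Ioi_subset_Ioi hs)) ?_)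
      filter_upwards [hA'le', ae_restrict_mem measurableSet_Ioi] with τ h1 h2
      exact h1.trans (neg_nonpos.2 (mul_nonneg hC.le
        (Real.rpow_nonneg (hY0 τ (le_of_lt h2)) _)))
    linarith [hYsub s t hs hst]
  -- Since `Y` is nonincreasing, its value at the right endpoint bounds the integrand on `[s, t]`.
  -- This form holds for all `s ≤ t`, so it yields the differential inequality at every point of
  -- differentiability, not just almost everywhere.
  have hdec : ∀ s t, t₀ ≤ s → s ≤ t → Y t - Y s ≤ -(C * Y t ^ (2 / δ₁) * (t - s)) :=
    fun s t hs hst => by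
    rw [hYsub s t hs hst]
    have hI : IntervalIntegrable A' volume s t :=
      (hA'i t (hs.trans hst)).mono_set (by
        rw [uIcc_of_le hst, uIcc_of_le (hs.trans hst)]; exact Icc_subset_Icc_left hs)
    have h1 : ∫ τ in s..t, A' τ ≤ ∫ _ in s..t, -(C * Y t ^ (2 / δ₁)) := by
      rw [intervalIntegral.integral_of_le hst, intervalIntegral.integral_of_le hst]
      refine integral_mono_ae hI.1 (integrable_const _) ?_
      filter_upwards [ae_restrict_of_ae_restrict_of_subset
        (Ioc_subset_Ioi_self.trans (Ioi_subset_Ioi hs)) hA'le',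
        ae_restrict_mem measurableSet_Ioc] with τ h1 h2
      refine h1.trans (neg_le_neg (mul_le_mul_of_nonneg_left ?_ hC.le))
      exact Real.rpow_le_rpow (hY0 t (hs.trans hst)) (hanti τ t (hs.trans h2.1.le) h2.2)
        (by positivity)
    refine h1.trans (le_of_eq ?_)
    rw [intervalIntegral.integral_const, smul_eq_mul]; ring
  have hAC : ∀ T, t₀ < T → AbsolutelyContinuousOnInterval Y t₀ T := fun T hT => by
    have h1 := ((LipschitzWith.const (Y t₀)).lipschitzOnWith.absolutelyContinuousOnInterval
      (a := t₀) (b := T)).add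
      ((hA'i T hT.le).absolutelyContinuousOnInterval_intervalIntegral left_mem_uIcc)
    refine h1.congr fun t ht => ?_
    rw [uIcc_of_le hT.le] at ht
    simp only [Pi.add_apply, ← hYsub t₀ t le_rfl ht.1]
    ring
  -- Chosen so that `2/δ₁ = σ + 1`; dividing by `Y^{σ+1}` makes `Y^{-σ}` grow at least linearly.
  set σ : ℝ := (2 - δ₁) / δ₁ with hσ
  have hσ0 : 0 < σ := div_pos (by linarith) (by linarith)
  have hσ1 : 2 / δ₁ = σ + 1 := by rw [hσ]; field_simp; ring
  have hσinv : -(δ₁ / (2 - δ₁)) = -σ⁻¹ := by rw [hσ, inv_div]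
  have hdecay : 0 < Y t₀ → ∀ t, t₀ ≤ t →
      Y t ≤ (C * σ * (t - t₀) + Y t₀ ^ (-σ)) ^ (-(δ₁ / (2 - δ₁))) := fun hpos t ht => by
    have hM : 0 < C * σ * (t - t₀) + Y t₀ ^ (-σ) := by
      have := Real.rpow_pos_of_pos hpos (-σ)
      have : 0 ≤ t - t₀ := by linarith
      positivity
    -- If `Y t = 0` the bound is trivial; otherwise monotonicity makes `Y` positive on all of `[t₀,
    -- t]`, as the comparison of negative powers requires.
    rcases (hY0 t ht).eq_or_lt with h1 | h1
    · rw [← h1]; exact Real.rpow_nonneg hM.le _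
    · have hYc : ContinuousOn Y (Icc t₀ t) := by
        have := (hAC (t + 1) (by linarith)).continuousOn
        rw [uIcc_of_le (by linarith)] at this
        exact this.mono (Icc_subset_Icc_right (by linarith))
      have h2 := Einstein.rpow_neg_ge_of_decay hσ0 ht hYc
        (fun s hs => h1.trans_le (hanti s t hs.1 hs.2))
        (C := C) (fun s r hs hsr _ => by rw [← hσ1]; exact hdec s r hs hsr)
      have h3 := Real.rpow_le_rpow_of_nonpos hM (by linarith : C * σ * (t - t₀) + Y t₀ ^ (-σ) ≤ _)
        (neg_nonpos.2 (inv_nonneg.2 hσ0.le))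
      rw [← Real.rpow_mul h1.le, neg_mul_neg, mul_inv_cancel₀ hσ0.ne', Real.rpow_one] at h3
      rwa [hσinv]
  have hzero : Y t₀ = 0 → ∀ t, t₀ ≤ t → Y t = 0 := fun h1 t ht =>
    le_antisymm ((hanti t₀ t le_rfl ht).trans_eq h1) (hY0 t ht)
  refine ⟨fun t ht => (hYi t ht).1.congr (hHu t ht _), fun t ht => (hZi t ht).congr (hHu t ht _),
    ⟨_, fun t ht => (hZt t ht).trans_le (hZb t ht)⟩, hAC,
    Einstein.ae_restrict_Ioi_of_forall_Icc fun T hT => (hAC T hT).ae_differentiableAt,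
    ⟨C, hC, fun t ht hd => ?_, hdecay⟩, hzero, ?_⟩
  -- Right slopes suffice: divide `hdec` by `z - t` and let `z ↓ t`, using continuity of `Y` at `t`.
  · have hs := (hasDerivAt_iff_tendsto_slope.1 hd.hasDerivAt).mono_left
      (nhdsWithin_mono t fun z (hz : z ∈ Ioi t) => ne_of_gt hz)
    have hc : Tendsto Y (𝓝[>] t) (𝓝 (Y t)) := hd.continuousAt.tendsto.mono_left nhdsWithin_le_nhds
    have hr := ((hc.rpow_const (p := 2 / δ₁) (Or.inr (by positivity))).const_mul C).neg
    have : deriv Y t ≤ -(C * Y t ^ (2 / δ₁)) := by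
      refine le_of_tendsto_of_tendsto hs hr ?_
      filter_upwards [self_mem_nhdsWithin] with z hz
      have hzt : 0 < z - t := sub_pos.2 hz
      rw [slope_def_field, div_le_iff₀ hzt]
      linarith [hdec t z ht.le (le_of_lt hz)]
    linarith
  · rcases (hY0 t₀ le_rfl).eq_or_lt with h1 | h1
    · refine tendsto_const_nhds.congr' ?_
      filter_upwards [eventually_ge_atTop t₀] with t ht using (hzero h1.symm t ht).symm
    · have hlin : Tendsto (fun t => C * σ * (t - t₀) + Y t₀ ^ (-σ)) atTop atTop :=
        tendsto_atTop_add_const_right _ _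
          ((tendsto_atTop_add_const_right _ (-t₀) tendsto_id).const_mul_atTop (mul_pos hC hσ0))
      have hlim := (tendsto_rpow_neg_atTop (y := δ₁ / (2 - δ₁))
        (div_pos (by linarith) (by linarith))).comp hlin
      refine tendsto_of_tendsto_of_tendsto_of_le_of_le' tendsto_const_nhds hlim ?_ ?_
      · filter_upwards [eventually_ge_atTop t₀] with t ht using hY0 t ht
      · filter_upwards [eventually_ge_atTop t₀] with t ht using hdecay h1 t ht
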